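/- Let $\Omega\subset\mathbb R^3$ be a bounded open set, and let the constitutive coefficients $\rho$, $c$, $a_{ij}$, $b_{ij}$, $d_{ij}$, $c_{ij}$, $K_{ij}$, $\tilde K_{ij}$, $A_{ijkl}$, $B_{ijkl}$, $C_{ijkl}$, $\tilde C_{ijkl}$ ($1\le i,j,k,l\le 3$) be real functions that are $C^1$ on $\overline\Omega$. Repeated subscripts are summed, $_{,j}$ denotes $\partial/\partial x_j$, a dot denotes the time derivative, and $e_{ij}=\tfrac12(u_{i,j}+u_{j,i})$. Assume that on $\overline\Omega$: (i) $A_{ijkl}=A_{jikl}=A_{klij}$, $B_{ijkl}=B_{jikl}=B_{klij}$, $C_{ijkl}=C_{jikl}=C_{klij}$, $\tilde C_{ijkl}=\tilde C_{klij}$, and $a_{ij},b_{ij},d_{ij},c_{ij},K_{ij},\tilde K_{ij}$ are symmetric in $i,j$; (ii) $\rho>0$, $c>0$, and the matrix $(c_{ij})$ is positive definite; and that there are constants $c_0,c_1>0$ such that for all $u_i,\tau,R_i,\theta,M_i\in W^{1,2}_0(\Omega)$ (iii) $\displaystyle\int_\Omega\big(A_{ijkl}e_{kl}e_{ij}+2B_{ijkl}e_{ij}R_{k,l}+K_{ij}\tau_{,i}\tau_{,j}+C_{ijkl}R_{i,j}R_{k,l}\big)\,dv\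 \ge\ c_0\int_\Omega\big(e_{ij}e_{ij}+\tau_{,i}\tau_{,i}+R_{i,j}R_{i,j}\big)\,dv;$ (iv) $\displaystyle\int_\Omega\big(\tilde K_{ij}\theta_{,i}\theta_{,j}+\tilde C_{ijkl}M_{l,k}M_{i,j}\big)\,dv\ \ge\ c_1\int_\Omega\big(\theta_{,i}\theta_{,i}+M_{i,j}M_{i,j}\big)\,dv.$ Consider the backward-in-time system of type III $$\rho\ddot u_i=(A_{jikl}e_{kl}+a_{ji}\dot\tau+B_{jikl}R_{l,k})_{,j}+\rho f_i,$$ $$c\ddot\tau=a_{ij}\dot e_{ij}+(d_{ij}\dot R_j+K_{ij}\tau_{,j}-\tilde K_{ij}\dot\tau_{,j})_{,i}+b_{ij}\dot R_{i,j}+\rho s,$$ $$c_{ij}\ddot R_j=(B_{klji}e_{kl}+b_{ji}\dot\tau+C_{jikl}R_{k,l}-\tilde C_{jikl}\dot R_{k,l})_{,j}+d_{ij}\dot\tau_{,j}+\rho Q_i$$ with boundary conditions $u_i=\tau=R_i=0$ on $\partial\Omega$. A solution on $[0,\infty)$ is a triple $(u_i,\tau,R_i)$ with $u_i,\tau,R_i\in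 C^1([0,\infty);W^{1,2}_0(\Omega))$ and $\dot u_i,\dot\tau,\dot R_i\in C^1([0,\infty);L^2(\Omega))$ that satisfies the three equations for every $t>0$ in the sense of distributions on $\Omega$. Then every solution with null sources $f_i=s=Q_i=0$ and null initial data $u_i=\dot u_i=\tau=\dot\tau=R_i=\dot R_i=0$ at $t=0$ satisfies $(u_i,\tau,R_i)=(0,0,0)$ for every $t\ge 0$. -/

import Mathlib

open MeasureTheory Set

namespace TypeIII

noncomputable section

/-- Three-dimensional Euclidean space. -/
abbrev E3 : Type := EuclideanSpace ℝ (Fin 3)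

/-- The `j`-th partial derivative of a scalar function. -/
def pderiv (j : Fin 3) (φ : E3 → ℝ) (x : E3) : ℝ :=
  fderiv ℝ φ x (EuclideanSpace.single j 1)

/-- The Lebesgue space `L²(Ω)`. -/
abbrev L2 (Ω : TopologicalSpace.Opens E3) : Type :=
  Lp ℝ 2 ((volume : Measure E3).restrict (Ω : Set E3))

/-- The Sobolev space `W₀^{1,2}(Ω)`: the closure of the smooth compactly supported functions in
the norm of `W^{1,2}(Ω)`. A function `w` is recorded together with its weak gradient, as the pair
`(w, (w_{,1}, w_{,2}, w_{,3}))` in `L²(Ω) × L²(Ω)³`; the norm is (equivalent to) the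
`W^{1,2}`-norm. -/
def H01 (Ω : TopologicalSpace.Opens E3) : Submodule ℝ (L2 Ω × (Fin 3 → L2 Ω)) :=
  (Submodule.span ℝ {p : L2 Ω × (Fin 3 → L2 Ω) | ∃ φ : TestFunction Ω ℝ ⊤,
    (p.1 : E3 → ℝ) =ᵐ[volume.restrict (Ω : Set E3)] (φ : E3 → ℝ) ∧
    ∀ j, (p.2 j : E3 → ℝ) =ᵐ[volume.restrict (Ω : Set E3)] pderiv j φ}).topologicalClosure

variable {Ω : TopologicalSpace.Opens E3}

/-- The function underlying an element of `W₀^{1,2}(Ω)`, as an element of `L²(Ω)`. -/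
def toL2 (w : H01 Ω) : L2 Ω := w.1.1

/-- The weak partial derivative `w_{,j}` of an element of `W₀^{1,2}(Ω)`. -/
def grad (w : H01 Ω) (j : Fin 3) : L2 Ω := w.1.2 j

/-- The linear strain `e_{ik} = (u_{i,k} + u_{k,i}) / 2` of a displacement field. -/
def strain (u : Fin 3 → H01 Ω) (i k : Fin 3) (x : E3) : ℝ :=
  (grad (u i) k x + grad (u k) i x) / 2

/-- The constitutive coefficients, as functions of the material point. -/
structure Material where
  /-- mass density -/
  rho : E3 → ℝ
  /-- thermal capacity `c` -/
  c : E3 → ℝ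
  /-- elasticity tensor `A_{ijkl}` -/
  A : Fin 3 → Fin 3 → Fin 3 → Fin 3 → E3 → ℝ
  /-- `B_{ijkl}` -/
  B : Fin 3 → Fin 3 → Fin 3 → Fin 3 → E3 → ℝ
  /-- `C_{ijkl}` -/
  C : Fin 3 → Fin 3 → Fin 3 → Fin 3 → E3 → ℝ
  /-- `C̃_{ijkl}` -/
  Ct : Fin 3 → Fin 3 → Fin 3 → Fin 3 → E3 → ℝ
  /-- thermal expansion `a_{ij}` -/
  a : Fin 3 → Fin 3 → E3 → ℝ
  /-- `b_{ij}` -/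
  b : Fin 3 → Fin 3 → E3 → ℝ
  /-- `d_{ij}` -/
  d : Fin 3 → Fin 3 → E3 → ℝ
  /-- `K_{ij}` -/
  K : Fin 3 → Fin 3 → E3 → ℝ
  /-- `K̃_{ij}` -/
  Kt : Fin 3 → Fin 3 → E3 → ℝ
  /-- the tensor `c_{ij}` -/
  cm : Fin 3 → Fin 3 → E3 → ℝ

namespace Material

/-- All coefficients are continuously differentiable on the closure of `Ω`. -/
structure IsC1 (m : Material) (Ω : TopologicalSpace.Opens E3) : Prop where
  rho : ContDiffOn ℝ 1 m.rho (closure (Ω : Set E3))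
  c : ContDiffOn ℝ 1 m.c (closure (Ω : Set E3))
  A : ∀ i j k l, ContDiffOn ℝ 1 (m.A i j k l) (closure (Ω : Set E3))
  B : ∀ i j k l, ContDiffOn ℝ 1 (m.B i j k l) (closure (Ω : Set E3))
  C : ∀ i j k l, ContDiffOn ℝ 1 (m.C i j k l) (closure (Ω : Set E3))
  Ct : ∀ i j k l, ContDiffOn ℝ 1 (m.Ct i j k l) (closure (Ω : Set E3))
  a : ∀ i j, ContDiffOn ℝ 1 (m.a i j) (closure (Ω : Set E3))
  b : ∀ i j, ContDiffOn ℝ 1 (m.b i j) (closure (Ω : Set E3))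
  d : ∀ i j, ContDiffOn ℝ 1 (m.d i j) (closure (Ω : Set E3))
  K : ∀ i j, ContDiffOn ℝ 1 (m.K i j) (closure (Ω : Set E3))
  Kt : ∀ i j, ContDiffOn ℝ 1 (m.Kt i j) (closure (Ω : Set E3))
  cm : ∀ i j, ContDiffOn ℝ 1 (m.cm i j) (closure (Ω : Set E3))

/-- The symmetry relations of the constitutive coefficients. -/
structure IsSymm (m : Material) (Ω : TopologicalSpace.Opens E3) : Prop where
  A_minor : ∀ x ∈ closure (Ω : Set E3), ∀ i j k l, m.A i j k l x = m.A j i k l x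
  A_major : ∀ x ∈ closure (Ω : Set E3), ∀ i j k l, m.A i j k l x = m.A k l i j x
  B_minor : ∀ x ∈ closure (Ω : Set E3), ∀ i j k l, m.B i j k l x = m.B j i k l x
  B_major : ∀ x ∈ closure (Ω : Set E3), ∀ i j k l, m.B i j k l x = m.B k l i j x
  C_minor : ∀ x ∈ closure (Ω : Set E3), ∀ i j k l, m.C i j k l x = m.C j i k l x
  C_major : ∀ x ∈ closure (Ω : Set E3), ∀ i j k l, m.C i j k l x = m.C k l i j x
  Ct_major : ∀ x ∈ closure (Ω : Set E3), ∀ i j k l, m.Ct i j k l x = m.Ct k l i j x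
  a : ∀ x ∈ closure (Ω : Set E3), ∀ i j, m.a i j x = m.a j i x
  b : ∀ x ∈ closure (Ω : Set E3), ∀ i j, m.b i j x = m.b j i x
  d : ∀ x ∈ closure (Ω : Set E3), ∀ i j, m.d i j x = m.d j i x
  K : ∀ x ∈ closure (Ω : Set E3), ∀ i j, m.K i j x = m.K j i x
  Kt : ∀ x ∈ closure (Ω : Set E3), ∀ i j, m.Kt i j x = m.Kt j i x
  cm : ∀ x ∈ closure (Ω : Set E3), ∀ i j, m.cm i j x = m.cm j i x

/-- The inertial coefficients `ρ`, `c` are positive and `c_{ij}` is positive definite. -/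
structure InertiaPos (m : Material) (Ω : TopologicalSpace.Opens E3) : Prop where
  rho : ∀ x ∈ closure (Ω : Set E3), 0 < m.rho x
  c : ∀ x ∈ closure (Ω : Set E3), 0 < m.c x
  cm : ∀ x ∈ closure (Ω : Set E3), ∀ ξ : Fin 3 → ℝ, ξ ≠ 0 →
    0 < ∑ i, ∑ j, m.cm i j x * ξ i * ξ j

/-- The stored energy is positive definite: for some `c₀ > 0` and all `u`, `τ`, `R` vanishing on
the boundary, the integral of
`A_{ijkl} e_{kl} e_{ij} + 2 B_{ijkl} e_{ij} R_{k,l} + K_{ij} τ_{,i} τ_{,j} + C_{ijkl} R_{i,j} R_{k,l}`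
is at least `c₀` times the integral of
`e_{ij} e_{ij} + τ_{,i} τ_{,i} + R_{i,j} R_{i,j}`. -/
def StoredEnergyPos (m : Material) (Ω : TopologicalSpace.Opens E3) : Prop :=
  ∃ c₀ : ℝ, 0 < c₀ ∧ ∀ (u : Fin 3 → H01 Ω) (τ : H01 Ω) (R : Fin 3 → H01 Ω),
    c₀ * ∫ x in (Ω : Set E3),
        ((∑ i, ∑ j, strain u i j x * strain u i j x)
          + (∑ i, grad τ i x * grad τ i x)
          + ∑ i, ∑ j, grad (R i) j x * grad (R i) j x)
      ≤ ∫ x in (Ω : Set E3),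
        ((∑ i, ∑ j, ∑ k, ∑ l, m.A i j k l x * strain u k l x * strain u i j x)
          + 2 * (∑ i, ∑ j, ∑ k, ∑ l, m.B i j k l x * strain u i j x * grad (R k) l x)
          + (∑ i, ∑ j, m.K i j x * grad τ i x * grad τ j x)
          + ∑ i, ∑ j, ∑ k, ∑ l, m.C i j k l x * grad (R i) j x * grad (R k) l x)

/-- The dissipation form `K̃_{ij} θ_{,i} θ_{,j} + C̃_{ijkl} M_{l,k} M_{i,j}` is positive definite:
for some `c₁ > 0` and all `θ`, `M` vanishing on the boundary, its integral is at least `c₁` times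
the integral of `θ_{,i} θ_{,i} + M_{i,j} M_{i,j}`. -/
def DissipationPos (m : Material) (Ω : TopologicalSpace.Opens E3) : Prop :=
  ∃ c₁ : ℝ, 0 < c₁ ∧ ∀ (θ : H01 Ω) (M : Fin 3 → H01 Ω),
    c₁ * ∫ x in (Ω : Set E3),
        ((∑ i, grad θ i x * grad θ i x) + ∑ i, ∑ j, grad (M i) j x * grad (M i) j x)
      ≤ ∫ x in (Ω : Set E3),
        ((∑ i, ∑ j, m.Kt i j x * grad θ i x * grad θ j x)
          + ∑ i, ∑ j, ∑ k, ∑ l, m.Ct i j k l x * grad (M l) k x * grad (M i) j x)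

end Material

/-- `q_{j,j} = g` in `Ω` in the sense of distributions. -/
def HasWeakDiv (Ω : TopologicalSpace.Opens E3) (q : Fin 3 → E3 → ℝ) (g : E3 → ℝ) : Prop :=
  ∀ φ : TestFunction Ω ℝ ⊤,
    ∫ x in (Ω : Set E3), g x * φ x = - ∫ x in (Ω : Set E3), ∑ j, q j x * pderiv j φ x

/-- The time derivative on `[0, ∞)` (one-sided at `0`). -/
def dt {X : Type*} [NormedAddCommGroup X] [NormedSpace ℝ X] (f : ℝ → X) (t : ℝ) : X :=
  derivWithin f (Ici 0) t

/-- `(u, τ, R)` solves, on `Ω × [0, ∞)`, the backward-in-time system with sources `f`, `s`, `Q`,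
homogeneous Dirichlet boundary conditions and initial data `u⁰, v⁰, τ⁰, θ⁰, R⁰, M⁰`.
The state `(u, u', τ, τ', R, R')` is a continuously differentiable function of `t ∈ [0, ∞)` with
values in the energy space, whose components lie in `W₀^{1,2}` and `L²` alternately; the
boundary conditions are the membership in `W₀^{1,2}`. -/
structure IsBackwardSolution (Ω : TopologicalSpace.Opens E3) (m : Material)
    (f : ℝ → Fin 3 → L2 Ω) (s : ℝ → L2 Ω) (Q : ℝ → Fin 3 → L2 Ω)
    (u₀ : Fin 3 → H01 Ω) (v₀ : Fin 3 → L2 Ω) (τ₀ : H01 Ω) (θ₀ : L2 Ω)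
    (R₀ : Fin 3 → H01 Ω) (M₀ : Fin 3 → L2 Ω)
    (u : ℝ → Fin 3 → H01 Ω) (τ : ℝ → H01 Ω) (R : ℝ → Fin 3 → H01 Ω) : Prop where
  contDiff_u : ContDiffOn ℝ 1 u (Ici 0)
  contDiff_v : ContDiffOn ℝ 1 (fun t i => toL2 (dt u t i)) (Ici 0)
  contDiff_τ : ContDiffOn ℝ 1 τ (Ici 0)
  contDiff_θ : ContDiffOn ℝ 1 (fun t => toL2 (dt τ t)) (Ici 0)
  contDiff_R : ContDiffOn ℝ 1 R (Ici 0)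
  contDiff_M : ContDiffOn ℝ 1 (fun t i => toL2 (dt R t i)) (Ici 0)
  init_u : u 0 = u₀
  init_v : ∀ i, toL2 (dt u 0 i) = v₀ i
  init_τ : τ 0 = τ₀
  init_θ : toL2 (dt τ 0) = θ₀
  init_R : R 0 = R₀
  init_M : ∀ i, toL2 (dt R 0 i) = M₀ i
  /-- `ρ u_i'' = (A_{jikl} e_{kl} + a_{ji} τ' + B_{jikl} R_{l,k})_{,j} + ρ f_i` -/
  momentum : ∀ t, 0 < t → ∀ i, HasWeakDiv Ω
    (fun j x => (∑ k, ∑ l, m.A j i k l x * strain (u t) k l x)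
      + m.a j i x * toL2 (dt τ t) x
      + ∑ k, ∑ l, m.B j i k l x * grad (R t l) k x)
    (fun x => m.rho x * dt (fun r i' => toL2 (dt u r i')) t i x - m.rho x * f t i x)
  /-- `c τ'' = a_{ij} e_{ij}' + (d_{ij} R_j' + K_{ij} τ_{,j} - K̃_{ij} τ_{,j}')_{,i}
  + b_{ij} R_{i,j}' + ρ s` -/
  entropy : ∀ t, 0 < t → HasWeakDiv Ω
    (fun i x => ∑ j, (m.d i j x * toL2 (dt R t j) x
      + m.K i j x * grad (τ t) j x
      - m.Kt i j x * grad (dt τ t) j x))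
    (fun x => m.c x * dt (fun r => toL2 (dt τ r)) t x
      - (∑ i, ∑ j, m.a i j x * strain (dt u t) i j x)
      - (∑ i, ∑ j, m.b i j x * grad (dt R t i) j x)
      - m.rho x * s t x)
  /-- `c_{ij} R_j'' = (B_{klji} e_{kl} + b_{ji} τ' + C_{jikl} R_{k,l} - C̃_{jikl} R_{k,l}')_{,j}
  + d_{ij} τ_{,j}' + ρ Q_i` -/
  moment : ∀ t, 0 < t → ∀ i, HasWeakDiv Ω
    (fun j x => (∑ k, ∑ l, m.B k l j i x * strain (u t) k l x)
      + m.b j i x * toL2 (dt τ t) x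
      + (∑ k, ∑ l, m.C j i k l x * grad (R t k) l x)
      - ∑ k, ∑ l, m.Ct j i k l x * grad (dt R t k) l x)
    (fun x => (∑ j, m.cm i j x * dt (fun r j' => toL2 (dt R r j')) t j x)
      - (∑ j, m.d i j x * grad (dt τ t) j x)
      - m.rho x * Q t i x)

end

end TypeIII

/-! Fix a time `T` and read the evolution backwards from it, with s = T - t. The anti-damped thermal
equations become damped ones, and the null data at t = 0 say that the reversed solution, started
from the state at `T`, is extinguished at the finite time s = T. The proof shows by complex analysis
that such extinction is impossible unless the state at `T` is zero.

The tool is the finite Laplace transform of the velocities, ∫₀ᵀ exp(-l (T - t)) w(t) dt (`lap`,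
`lapPair`). It is entire of exponential type, bounded on Re l ≥ 0, and tends to zero along the
positive real axis. Because the data at t = 0 vanish, integration by parts leaves only boundary
terms at `T`, so the transform solves the resolvent equation of the damped system with the state at
`T` as data (`lap_deriv`, `IsNullSolution.isResolvent`). If it is also bounded on two rays in the
open left half plane, Phragmén-Lindelöf in the three sectors cut out by these rays and the positive
real axis, followed by Liouville, makes it zero (`eq_zero_of_bounded_on_rays`). Its value at l = 0
is the increment of the position over [0, T], which is the position at `T`.

The bound on the rays l = r(-σ ± iκ), σ small, is `exists_resolvent_bound`. The mechanical equation
is conservative, but l and l⁻¹ both have negative real part there, so testing it with its own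
velocity v controls r‖v‖² + ‖e(v)‖²/r. The thermal equations are parabolic: for σ small against the
damping, testing with the thermal velocity z controls ‖z‖² in the energy norm and r‖z‖² in L². In
these weights all couplings are of lower order. The elastic ones carry a factor l⁻¹. In the thermal
stress and its counterpart the derivative is moved off the displacement by parts, which is where `a`
being C¹ matters (`exists_abs_coefForm_grad_le`). For large r the couplings are absorbed
(`le_one_of_weighted_bounds`).

The argument is carried out for abstract forms, `CoupledForms`. For the concrete system, the stored
energy at τ = R = 0 gives coercivity of the stiffness on strains, the dissipation inequality gives
coercivity of the damping up to an L² term, and the distributional equations extend to test fields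
in `W₀^{1,2}` by density. -/

namespace TypeIII

/-! ### Phragmén-Lindelöf on three rays. -/

/-- An entire function of exponential type that is bounded on two rays enclosing an angle less
than `π` is bounded in between. -/
theorem norm_le_of_norm_le_on_rays {g : ℂ → ℂ} (hg : Differentiable ℂ g) {C T M a b : ℝ}
    (hgrow : ∀ z, ‖g z‖ ≤ C * Real.exp (T * ‖z‖)) (hab : b - a < Real.pi) (hlt : a < b)
    (ha : ∀ r : ℝ, 0 < r → ‖g (r * Complex.exp (a * Complex.I))‖ ≤ M)
    (hb : ∀ r : ℝ, 0 < r → ‖g (r * Complex.exp (b * Complex.I))‖ ≤ M)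
    {r θ : ℝ} (hr : 0 < r) (h1 : a ≤ θ) (h2 : θ ≤ b) :
    ‖g (r * Complex.exp (θ * Complex.I))‖ ≤ M := by
  have key : ∀ z : ℂ, Complex.exp z = (Real.exp z.re : ℝ) * Complex.exp (z.im * Complex.I) := by
    intro z
    rw [Complex.ofReal_exp, ← Complex.exp_add, Complex.re_add_im]
  -- The exponential maps the strip a ≤ Im ≤ b onto the sector.
  have hz := PhragmenLindelof.horizontal_strip (a := a) (b := b) (C := M)
    (f := fun z => g (Complex.exp z)) (z := Complex.log r + θ * Complex.I)
    (hg.comp Complex.differentiable_exp).diffContOnCl ?_ ?_ ?_ ?_ ?_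
  · simpa [Complex.exp_add, Complex.exp_log (Complex.ofReal_ne_zero.2 hr.ne')] using hz
  -- After composition with the exponential, exponential type is growth exp(|T| exp(|Re z|)), with
  -- rate 1. The strip principle allows any rate below π / (b - a), so the condition is exactly that
  -- the angle is less than π.
  · refine ⟨1, (one_lt_div (by linarith)).2 hab, |T|, ?_⟩
    refine Asymptotics.IsBigO.of_bound |C| (Filter.Eventually.of_forall fun z => ?_)
    refine (hgrow _).trans ?_
    rw [Real.norm_of_nonneg (Real.exp_pos _).le, Complex.norm_exp]
    refine mul_le_mul (le_abs_self C) ?_ (Real.exp_pos _).le (abs_nonneg C)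
    refine Real.exp_le_exp.2 (mul_le_mul (le_abs_self T) ?_ (Real.exp_pos _).le (abs_nonneg T))
    rw [one_mul]
    exact Real.exp_le_exp.2 (le_abs_self _)
  · intro z hz
    change ‖g (Complex.exp z)‖ ≤ M
    rw [key, hz]
    exact ha _ (Real.exp_pos _)
  · intro z hz
    change ‖g (Complex.exp z)‖ ≤ M
    rw [key, hz]
    exact hb _ (Real.exp_pos _)
  · simpa [← Complex.ofReal_log hr.le] using h1
  · simpa [← Complex.ofReal_log hr.le] using h2

/-- An entire function of exponential type that is bounded on three rays, pairwise enclosing angles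
less than `π`, and tends to zero along the positive real axis vanishes. -/
theorem eq_zero_of_bounded_on_rays {g : ℂ → ℂ} (hg : Differentiable ℂ g) {C T M σ κ : ℝ}
    (hgrow : ∀ z, ‖g z‖ ≤ C * Real.exp (T * ‖z‖)) (hσ : 0 < σ) (hκ : 0 < κ)
    (hσκ : σ ^ 2 + κ ^ 2 = 1)
    (h0 : ∀ r : ℝ, 0 < r → ‖g r‖ ≤ M)
    (hp : ∀ r : ℝ, 0 < r → ‖g (r * ⟨-σ, κ⟩)‖ ≤ M)
    (hm : ∀ r : ℝ, 0 < r → ‖g (r * ⟨-σ, -κ⟩)‖ ≤ M)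
    (hlim : Filter.Tendsto (fun r : ℝ => g r) Filter.atTop (nhds 0)) (z : ℂ) : g z = 0 := by
  set w : ℂ := ⟨-σ, κ⟩ with hw
  set φ := Complex.arg w with hφ
  have hwn : ‖w‖ = 1 := by
    rw [Complex.norm_def, Complex.normSq_apply, Real.sqrt_eq_one]
    simp only [hw]
    linarith
  have hφ1 : Complex.exp (φ * Complex.I) = w := by
    have := Complex.norm_mul_exp_arg_mul_I w
    rwa [hwn, Complex.ofReal_one, one_mul] at this
  have hsin : Real.sin φ = κ := by
    have := congrArg Complex.im hφ1
    rwa [Complex.exp_ofReal_mul_I_im] at this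
  have hcos : Real.cos φ = -σ := by
    have := congrArg Complex.re hφ1
    rwa [Complex.exp_ofReal_mul_I_re] at this
  have hφ2 : φ < Real.pi := by
    refine lt_of_le_of_ne (Complex.arg_le_pi w) fun h => ?_
    rw [h, Real.sin_pi] at hsin
    linarith
  have hφ0 : 0 ≤ φ := Complex.arg_nonneg_iff.2 hκ.le
  -- Since -σ < 0 the rays lie in the open left half plane, so the sector between them across the
  -- negative axis has opening 2π - 2φ < π.
  have hφ3 : Real.pi / 2 < φ := by
    by_contra! h
    have := Real.cos_nonneg_of_neg_pi_div_two_le_of_le (by linarith) h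
    linarith
  have hpos := Real.pi_pos
  have hexpm : Complex.exp ((-φ : ℝ) * Complex.I) = ⟨-σ, -κ⟩ := by
    apply Complex.ext
    · rw [Complex.exp_ofReal_mul_I_re, Real.cos_neg, hcos]
    · rw [Complex.exp_ofReal_mul_I_im, Real.sin_neg, hsin]
  -- The lower ray is given a second angle, so that the sector across the negative axis is also an
  -- interval of angles, free of the jump of the argument.
  have hexpm' : Complex.exp ((2 * Real.pi - φ : ℝ) * Complex.I) = ⟨-σ, -κ⟩ := by
    apply Complex.ext
    · rw [Complex.exp_ofReal_mul_I_re, Real.cos_two_pi_sub, hcos]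
    · rw [Complex.exp_ofReal_mul_I_im, Real.sin_two_pi_sub, hsin]
  have rp : ∀ r : ℝ, 0 < r → ‖g (r * Complex.exp (φ * Complex.I))‖ ≤ M := by
    intro r hr; rw [hφ1]; exact hp r hr
  have rm : ∀ r : ℝ, 0 < r → ‖g (r * Complex.exp ((-φ : ℝ) * Complex.I))‖ ≤ M := by
    intro r hr; rw [hexpm]; exact hm r hr
  have rm' : ∀ r : ℝ, 0 < r → ‖g (r * Complex.exp ((2 * Real.pi - φ : ℝ) * Complex.I))‖ ≤ M := by
    intro r hr; rw [hexpm']; exact hm r hr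
  have r0 : ∀ r : ℝ, 0 < r → ‖g (r * Complex.exp ((0 : ℝ) * Complex.I))‖ ≤ M := by
    intro r hr; simpa using h0 r hr
  have hbd : ∀ z, ‖g z‖ ≤ max M ‖g 0‖ := by
    intro z
    rcases eq_or_ne z 0 with rfl | hz
    · exact le_max_right _ _
    refine le_trans ?_ (le_max_left _ _)
    have hzn : 0 < ‖z‖ := norm_pos_iff.2 hz
    have hpol := Complex.norm_mul_exp_arg_mul_I z
    have h1 := Complex.neg_pi_lt_arg z
    have h2 := Complex.arg_le_pi z
    rcases le_or_gt (Complex.arg z) φ with h3 | h3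
    · rcases le_or_gt 0 (Complex.arg z) with h4 | h4
      · rw [← hpol]
        exact norm_le_of_norm_le_on_rays hg hgrow (by linarith) (by linarith) r0 rp hzn h4 h3
      · rcases le_or_gt (-φ) (Complex.arg z) with h5 | h5
        · rw [← hpol]
          exact norm_le_of_norm_le_on_rays hg hgrow (by linarith) (by linarith) rm r0 hzn h5 h4.le
        · have hpol' : (‖z‖ : ℂ) * Complex.exp ((Complex.arg z + 2 * Real.pi : ℝ) * Complex.I)
              = z := by
            push_cast
            rw [add_mul, Complex.exp_add, Complex.exp_two_pi_mul_I, mul_one, hpol]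
          rw [← hpol']
          exact norm_le_of_norm_le_on_rays hg hgrow (by linarith) (by linarith) rp rm' hzn
            (by linarith) (by linarith)
    · rw [← hpol]
      exact norm_le_of_norm_le_on_rays hg hgrow (by linarith) (by linarith) rp rm' hzn h3.le
        (by linarith)
  -- Liouville; the limit along the positive axis then identifies the constant.
  have hconst := hg.apply_eq_apply_of_bounded
    (isBounded_iff_forall_norm_le.2 ⟨_, by rintro _ ⟨z, rfl⟩; exact hbd z⟩)
  have : (fun r : ℝ => g r) = fun _ => g z := funext fun r => hconst _ _
  rw [this] at hlim
  exact tendsto_nhds_unique tendsto_const_nhds hlim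

end TypeIII

/-! ### Complexified forms and the abstract coupled system. -/

namespace TypeIII

section Sesquilinear

variable {X Y : Type*} [NormedAddCommGroup X] [NormedSpace ℝ X] [NormedAddCommGroup Y]
  [NormedSpace ℝ Y]

/-- The complex-linear extension of a real form in its first argument, at the complex vector
`p.1 + i p.2`. -/
noncomputable def cval (b : X →L[ℝ] Y →L[ℝ] ℝ) (p : X × X) (y : Y) : ℂ :=
  ⟨b p.1 y, b p.2 y⟩

/-- The sesquilinear extension of a real form, at the complex vectors `p.1 + i p.2` and
`q.1 + i q.2`. -/
noncomputable def sesq (b : X →L[ℝ] Y →L[ℝ] ℝ) (p : X × X) (q : Y × Y) : ℂ :=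
  cval b p q.1 - Complex.I * cval b p q.2

/-- A norm of the complex vector `p.1 + i p.2`. -/
def pairNorm (p : X × X) : ℝ := ‖p.1‖ + ‖p.2‖

omit [NormedSpace ℝ X] in
theorem pairNorm_nonneg (p : X × X) : 0 ≤ pairNorm p := add_nonneg (norm_nonneg _) (norm_nonneg _)

theorem norm_cval_le (b : X →L[ℝ] Y →L[ℝ] ℝ) (p : X × X) (y : Y) :
    ‖cval b p y‖ ≤ ‖b‖ * pairNorm p * ‖y‖ := by
  refine (Complex.norm_le_abs_re_add_abs_im _).trans ?_
  have h1 := b.le_opNorm₂ p.1 y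
  have h2 := b.le_opNorm₂ p.2 y
  simp only [Real.norm_eq_abs] at h1 h2
  simp only [cval, pairNorm]
  linarith

theorem norm_sesq_le (b : X →L[ℝ] Y →L[ℝ] ℝ) (p : X × X) (q : Y × Y) :
    ‖sesq b p q‖ ≤ ‖b‖ * pairNorm p * pairNorm q := by
  refine (norm_sub_le _ _).trans ?_
  have h1 := norm_cval_le b p q.1
  have h2 := norm_cval_le b p q.2
  rw [norm_mul, Complex.norm_I, one_mul, pairNorm.eq_def q]
  linarith

theorem norm_sesq_prodMk_zero_le (b : X →L[ℝ] Y →L[ℝ] ℝ) (x : X) (q : Y × Y) :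
    ‖sesq b (x, 0) q‖ ≤ ‖b‖ * ‖x‖ * pairNorm q := by
  have := norm_sesq_le b (x, 0) q
  rwa [show pairNorm (x, (0 : X)) = ‖x‖ by simp [pairNorm]] at this

theorem sesq_re (b : X →L[ℝ] Y →L[ℝ] ℝ) (p : X × X) (q : Y × Y) :
    (sesq b p q).re = b p.1 q.1 + b p.2 q.2 := by
  simp [sesq, cval]

/-- The imaginary part is the commutator b(p₂, p₁) - b(p₁, p₂). Energies of symmetric forms are thus
real, so multiplying one by l scales it by Re l in the real part. -/
theorem sesq_self_of_symm {b : X →L[ℝ] X →L[ℝ] ℝ} (hb : ∀ x y, b x y = b y x) (p : X × X) :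
    sesq b p p = ((b p.1 p.1 + b p.2 p.2 : ℝ) : ℂ) := by
  apply Complex.ext
  · rw [sesq_re, Complex.ofReal_re]
  · simp [sesq, cval, hb p.2 p.1]

omit [NormedSpace ℝ X] in
theorem sq_pairNorm_le (p : X × X) : pairNorm p ^ 2 ≤ 2 * (‖p.1‖ ^ 2 + ‖p.2‖ ^ 2) := by
  rw [pairNorm]
  nlinarith [sq_nonneg (‖p.1‖ - ‖p.2‖)]

end Sesquilinear

/-- The forms of a second order evolution equation for a conservative unknown `u` in `Vu` coupled
to an equation with strong damping `D` for an unknown `y` in `Vz`. -/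
structure CoupledForms (Vu Vz Hu Hz F : Type*)
    [NormedAddCommGroup Vu] [NormedSpace ℝ Vu] [NormedAddCommGroup Vz] [NormedSpace ℝ Vz]
    [NormedAddCommGroup Hu] [NormedSpace ℝ Hu] [NormedAddCommGroup Hz] [NormedSpace ℝ Hz]
    [NormedAddCommGroup F] [NormedSpace ℝ F] where
  /-- the embedding of `Vu` into the pivot space -/
  ju : Vu →L[ℝ] Hu
  /-- the embedding of `Vz` into the pivot space -/
  jz : Vz →L[ℝ] Hz
  /-- the strain -/
  E : Vu →L[ℝ] F
  /-- the inertia of `u` -/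
  mu : Hu →L[ℝ] Hu →L[ℝ] ℝ
  /-- the inertia of `y` -/
  mz : Hz →L[ℝ] Hz →L[ℝ] ℝ
  /-- the stiffness of `u` -/
  A : F →L[ℝ] F →L[ℝ] ℝ
  /-- the elastic coupling in the equation for `u` -/
  B₁ : Vz →L[ℝ] F →L[ℝ] ℝ
  /-- the elastic coupling in the equation for `y` -/
  B₂ : F →L[ℝ] Vz →L[ℝ] ℝ
  /-- the stiffness of `y` -/
  K : Vz →L[ℝ] Vz →L[ℝ] ℝ
  /-- the damping of `y` -/
  D : Vz →L[ℝ] Vz →L[ℝ] ℝ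
  /-- the velocity coupling in the equation for `u` -/
  n₁ : Vz →L[ℝ] Vu →L[ℝ] ℝ
  /-- the velocity coupling in the equation for `y` -/
  n₂ : Vu →L[ℝ] Vz →L[ℝ] ℝ
  /-- lower order terms in the equation for `y` -/
  S₁ : Hz →L[ℝ] Vz →L[ℝ] ℝ
  /-- lower order terms in the equation for `y` -/
  S₂ : Vz →L[ℝ] Hz →L[ℝ] ℝ
  mu_symm : ∀ x y, mu x y = mu y x
  mz_symm : ∀ x y, mz x y = mz y x
  A_symm : ∀ x y, A (E x) (E y) = A (E y) (E x)
  mu_pos : ∃ c > 0, ∀ x, c * ‖x‖ ^ 2 ≤ mu x x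
  mz_pos : ∃ c > 0, ∀ x, c * ‖x‖ ^ 2 ≤ mz x x
  A_pos : ∃ c > 0, ∀ x, c * ‖E x‖ ^ 2 ≤ A (E x) (E x)
  D_pos : ∃ c > 0, ∃ C, ∀ z, c * ‖z‖ ^ 2 ≤ D z z + C * ‖jz z‖ ^ 2
  n₁_le : ∃ C, ∀ z x, |n₁ z x| ≤ C * ‖z‖ * ‖ju x‖
  n₂_le : ∃ C, ∀ x z, |n₂ x z| ≤ C * ‖ju x‖ * ‖z‖

/-- The elementary inequality behind the resolvent estimate. -/
theorem le_one_of_weighted_bounds {K r V N G b : ℝ} (hK : 0 ≤ K) (hr : 1 ≤ r)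
    (hrK : (64 * K) ^ 2 ≤ r)
    (hV : 0 ≤ V) (hN : 0 ≤ N) (hG : 0 ≤ G) (hb : 0 ≤ b)
    (h1 : r * V ^ 2 + N ^ 2 / r ≤ K * (b * N / r + b * V + V + N / r))
    (h2 : b ^ 2 + r * G ^ 2 ≤
      K * (G ^ 2 + G + b / r + N * b / r + b ^ 2 / r + V * b + G * b)) :
    V ≤ 1 ∧ G ≤ 1 := by
  obtain ⟨R, hR1, rfl⟩ : ∃ R : ℝ, 1 ≤ R ∧ r = R ^ 2 :=
    -- With r = R², V = x / R, G = a / R and N = y R, the left sides become x² + y² and a² + b²,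
    -- while the right sides keep a factor K / R in front of quadratic and linear terms.
    ⟨√r, Real.one_le_sqrt.2 hr, (Real.sq_sqrt (by linarith)).symm⟩
  have hRK : 64 * K ≤ R := (sq_le_sq₀ (by positivity) (by positivity)).1 hrK
  have hR0 : 0 < R := by linarith
  obtain ⟨x, rfl⟩ : ∃ x, V = x / R := ⟨V * R, by field_simp⟩
  obtain ⟨a, rfl⟩ : ∃ a, G = a / R := ⟨G * R, by field_simp⟩
  obtain ⟨y, rfl⟩ : ∃ y, N = y * R := ⟨N / R, by field_simp⟩
  have hx : 0 ≤ x := by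
    by_contra! h
    exact absurd hV (not_le.2 (div_neg_of_neg_of_pos h hR0))
  have ha : 0 ≤ a := by
    by_contra! h
    exact absurd hG (not_le.2 (div_neg_of_neg_of_pos h hR0))
  have hy : 0 ≤ y := nonneg_of_mul_nonneg_left hN hR0
  have e1 : R ^ 2 * (x / R) ^ 2 + (y * R) ^ 2 / R ^ 2 = x ^ 2 + y ^ 2 := by field_simp
  have e2 : K * (b * (y * R) / R ^ 2 + b * (x / R) + x / R + y * R / R ^ 2)
      = K * (b * y + b * x + x + y) / R := by field_simp
  have e3 : b ^ 2 + R ^ 2 * (a / R) ^ 2 = b ^ 2 + a ^ 2 := by field_simp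
  have e4 : K * ((a / R) ^ 2 + a / R + b / R ^ 2 + y * R * b / R ^ 2 + b ^ 2 / R ^ 2 + x / R * b
      + a / R * b) = K * ((a ^ 2 + b + b ^ 2) / R + (a + y * b + x * b + a * b)) / R := by
    field_simp
    ring
  have h3 : (a ^ 2 + b + b ^ 2) / R ≤ a ^ 2 + b + b ^ 2 := div_le_self (by positivity) hR1
  rw [e1, e2, le_div_iff₀ hR0] at h1
  rw [e3, e4, le_div_iff₀ hR0] at h2
  have h4 := mul_le_mul_of_nonneg_left h3 hK
  set s := x + y + a + b with hs
  have hs0 : 0 ≤ s := by positivity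
  have h5 : R * s ^ 2 ≤ 4 * (R * (x ^ 2 + y ^ 2 + (b ^ 2 + a ^ 2))) := by
    have : s ^ 2 ≤ 4 * (x ^ 2 + y ^ 2 + (b ^ 2 + a ^ 2)) := by
      rw [hs]
      linarith [sq_nonneg (x - y), sq_nonneg (x - a), sq_nonneg (x - b), sq_nonneg (y - a),
        sq_nonneg (y - b), sq_nonneg (a - b)]
    linarith [mul_le_mul_of_nonneg_left this hR0.le]
  have h6 : b * y + b * x + x + y + (a ^ 2 + b + b ^ 2 + (a + y * b + x * b + a * b))
      ≤ 2 * s ^ 2 + 2 * s := by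
    have e5 : s ^ 2 = x ^ 2 + y ^ 2 + a ^ 2 + b ^ 2
        + 2 * (x * y + x * a + x * b + y * a + y * b + a * b) := by rw [hs]; ring
    have := mul_nonneg hx hy
    have := mul_nonneg hx ha
    have := mul_nonneg hx hb
    have := mul_nonneg hy ha
    have := mul_nonneg hy hb
    have := mul_nonneg ha hb
    have := sq_nonneg x
    have := sq_nonneg y
    have := sq_nonneg a
    have := sq_nonneg b
    linarith
  have h7 := mul_le_mul_of_nonneg_left h6 hK
  have h8 : R * s ^ 2 ≤ 8 * K * (s ^ 2 + s) := by linarith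
  -- Here 64 K ≤ R enters: the quadratic part on the right is absorbed and s is bounded by an
  -- absolute constant.
  have h9 : R * s ^ 2 ≤ R / 8 * (s ^ 2 + s) :=
    h8.trans (mul_le_mul_of_nonneg_right (by linarith) (by positivity))
  have h10 : s ≤ 1 := by
    by_contra! h
    have h11 : s ^ 2 ≤ (s ^ 2 + s) / 8 := le_of_mul_le_mul_left (by linarith) hR0
    have h12 : s * 1 ≤ s * s := mul_le_mul_of_nonneg_left h.le hs0
    linarith
  exact ⟨(div_le_one hR0).2 (by linarith), (div_le_one hR0).2 (by linarith)⟩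

end TypeIII

/-! ### The resolvent estimate. -/

namespace TypeIII

namespace CoupledForms

variable {Vu Vz Hu Hz F : Type*}
    [NormedAddCommGroup Vu] [NormedSpace ℝ Vu] [NormedAddCommGroup Vz] [NormedSpace ℝ Vz]
    [NormedAddCommGroup Hu] [NormedSpace ℝ Hu] [NormedAddCommGroup Hz] [NormedSpace ℝ Hz]
    [NormedAddCommGroup F] [NormedSpace ℝ F]

/-- The Laplace transformed system at `l`, for the complex velocities `v` and `z`, with data
`v₀`, `e₀`, `z₀`, `y₀`. -/
structure IsResolvent (S : CoupledForms Vu Vz Hu Hz F) (l : ℂ) (v₀ : Hu) (e₀ : F) (z₀ : Hz)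
    (y₀ : Vz) (v : Vu × Vu) (z : Vz × Vz) : Prop where
  eq_u : ∀ φ, l * cval S.mu (v.map S.ju S.ju) (S.ju φ)
      + l⁻¹ * (cval S.A (v.map S.E S.E) (S.E φ) + cval S.B₁ z (S.E φ)) - cval S.n₁ z φ
    = cval S.mu (v₀, 0) (S.ju φ) + l⁻¹ * (cval S.A (e₀, 0) (S.E φ) + cval S.B₁ (y₀, 0) (S.E φ))
  eq_z : ∀ ψ, l * cval S.mz (z.map S.jz S.jz) (S.jz ψ) + cval S.D z ψ
    = cval S.mz (z₀, 0) (S.jz ψ) + l⁻¹ * (cval S.B₂ (e₀, 0) ψ + cval S.K (y₀, 0) ψ)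
      - l⁻¹ * (cval S.B₂ (v.map S.E S.E) ψ + cval S.K z ψ)
      + cval S.n₂ v ψ + cval S.S₁ (z.map S.jz S.jz) ψ + cval S.S₂ z (S.jz ψ)

variable {S : CoupledForms Vu Vz Hu Hz F} {l : ℂ} {v₀ : Hu} {e₀ : F} {z₀ : Hz}
    {y₀ : Vz} {v : Vu × Vu} {z : Vz × Vz}

/-- The equation holds for real test vectors; taking it at `v.1` minus i times it at `v.2` tests it
with the complex conjugate of v. The two energies stay on the left, and everything else is treated
as a perturbation. -/
theorem IsResolvent.sesq_u (h : S.IsResolvent l v₀ e₀ z₀ y₀ v z) :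
    l * sesq S.mu (v.map S.ju S.ju) (v.map S.ju S.ju)
      + l⁻¹ * sesq S.A (v.map S.E S.E) (v.map S.E S.E)
    = sesq S.mu (v₀, 0) (v.map S.ju S.ju) + l⁻¹ * (sesq S.A (e₀, 0) (v.map S.E S.E)
      + sesq S.B₁ (y₀, 0) (v.map S.E S.E)) - l⁻¹ * sesq S.B₁ z (v.map S.E S.E)
      + sesq S.n₁ z v := by
  have h1 := h.eq_u v.1
  have h2 := h.eq_u v.2
  simp only [sesq, Prod.map_fst, Prod.map_snd]
  linear_combination h1 - Complex.I * h2

theorem IsResolvent.sesq_z (h : S.IsResolvent l v₀ e₀ z₀ y₀ v z) :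
    l * sesq S.mz (z.map S.jz S.jz) (z.map S.jz S.jz) + sesq S.D z z
    = sesq S.mz (z₀, 0) (z.map S.jz S.jz) + l⁻¹ * (sesq S.B₂ (e₀, 0) z + sesq S.K (y₀, 0) z)
      - l⁻¹ * (sesq S.B₂ (v.map S.E S.E) z + sesq S.K z z)
      + sesq S.n₂ v z + sesq S.S₁ (z.map S.jz S.jz) z + sesq S.S₂ z (z.map S.jz S.jz) := by
  have h1 := h.eq_z z.1
  have h2 := h.eq_z z.2
  simp only [sesq, Prod.map_fst, Prod.map_snd]
  linear_combination h1 - Complex.I * h2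

/-- Needed for the velocity couplings, which are bounded by the pivot norm of the displacement rate
and not merely by its norm in `Vu`. -/
theorem norm_sesq_le_of_le {X Y : Type*} [NormedAddCommGroup X] [NormedSpace ℝ X]
    [NormedAddCommGroup Y] [NormedSpace ℝ Y] {b : X →L[ℝ] Y →L[ℝ] ℝ} {p : X × X} {q : Y × Y}
    {f : X → ℝ} {g : Y → ℝ} {C : ℝ} (h : ∀ x y, |b x y| ≤ C * f x * g y) :
    ‖sesq b p q‖ ≤ C * (f p.1 + f p.2) * (g q.1 + g q.2) := by
  refine (Complex.norm_le_abs_re_add_abs_im _).trans ?_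
  have h1 : (sesq b p q).im = b p.2 q.1 - b p.1 q.2 := by simp [sesq, cval]
  rw [h1, sesq_re]
  have := abs_add_le (b p.1 q.1) (b p.2 q.2)
  have := abs_sub (b p.2 q.1) (b p.1 q.2)
  have := h p.1 q.1
  have := h p.2 q.2
  have := h p.2 q.1
  have := h p.1 q.2
  linarith

/-- Bound for the right-hand side of the equation for `u`. -/
theorem IsResolvent.exists_bound_u (S : CoupledForms Vu Vz Hu Hz F) (v₀ : Hu) (e₀ : F) (z₀ : Hz)
    (y₀ : Vz) : ∃ C, 0 ≤ C ∧ ∀ (l : ℂ) (v : Vu × Vu) (z : Vz × Vz),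
    S.IsResolvent l v₀ e₀ z₀ y₀ v z →
    ‖l * sesq S.mu (v.map S.ju S.ju) (v.map S.ju S.ju)
      + l⁻¹ * sesq S.A (v.map S.E S.E) (v.map S.E S.E)‖ ≤
    C * (pairNorm z * pairNorm (v.map S.E S.E) / ‖l‖ + pairNorm z * pairNorm (v.map S.ju S.ju)
      + pairNorm (v.map S.ju S.ju) + pairNorm (v.map S.E S.E) / ‖l‖) := by
  obtain ⟨Cn, hCn⟩ := S.n₁_le
  refine ⟨‖S.mu‖ * ‖v₀‖ + (‖S.A‖ * ‖e₀‖ + ‖S.B₁‖ * ‖y₀‖) + ‖S.B₁‖ + |Cn|, by positivity, ?_⟩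
  intro l v z h
  rw [h.sesq_u]
  set N := pairNorm (v.map S.E S.E)
  set V := pairNorm (v.map S.ju S.ju)
  set b := pairNorm z
  have hN : 0 ≤ N := pairNorm_nonneg _
  have hV : 0 ≤ V := pairNorm_nonneg _
  have hb : 0 ≤ b := pairNorm_nonneg _
  have t1 : ‖sesq S.mu (v₀, 0) (v.map S.ju S.ju)‖ ≤ ‖S.mu‖ * ‖v₀‖ * V :=
    norm_sesq_prodMk_zero_le _ _ _
  have t2 : ‖sesq S.A (e₀, 0) (v.map S.E S.E)‖ ≤ ‖S.A‖ * ‖e₀‖ * N :=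
    norm_sesq_prodMk_zero_le _ _ _
  have t3 : ‖sesq S.B₁ (y₀, 0) (v.map S.E S.E)‖ ≤ ‖S.B₁‖ * ‖y₀‖ * N :=
    norm_sesq_prodMk_zero_le _ _ _
  have t4 : ‖sesq S.B₁ z (v.map S.E S.E)‖ ≤ ‖S.B₁‖ * b * N := norm_sesq_le _ _ _
  -- A bound b N without the factor 1 / ‖l‖ could not be absorbed, since the strain norm N has only
  -- the weight 1 / ‖l‖ on the left; hence the pivot norm V.
  have t5 : ‖sesq S.n₁ z v‖ ≤ |Cn| * b * V := by
    refine (norm_sesq_le_of_le (f := fun x => ‖x‖) (g := fun x => ‖S.ju x‖) hCn).trans ?_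
    exact mul_le_mul_of_nonneg_right (mul_le_mul_of_nonneg_right (le_abs_self _) hb) hV
  have hl : 0 ≤ ‖l‖⁻¹ := by positivity
  have e1 : ‖l⁻¹ * (sesq S.A (e₀, 0) (v.map S.E S.E) + sesq S.B₁ (y₀, 0) (v.map S.E S.E))‖
      ≤ ‖l‖⁻¹ * (‖S.A‖ * ‖e₀‖ * N + ‖S.B₁‖ * ‖y₀‖ * N) := by
    rw [norm_mul, norm_inv]
    exact mul_le_mul_of_nonneg_left ((norm_add_le _ _).trans (add_le_add t2 t3)) hl
  have e2 : ‖l⁻¹ * sesq S.B₁ z (v.map S.E S.E)‖ ≤ ‖l‖⁻¹ * (‖S.B₁‖ * b * N) := by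
    rw [norm_mul, norm_inv]
    exact mul_le_mul_of_nonneg_left t4 hl
  refine (norm_add_le _ _).trans ?_
  refine (add_le_add ((norm_sub_le _ _).trans (add_le_add ((norm_add_le _ _).trans
    (add_le_add t1 e1)) e2)) t5).trans ?_
  set m := ‖S.mu‖ * ‖v₀‖ with hm
  set d := ‖S.A‖ * ‖e₀‖ + ‖S.B₁‖ * ‖y₀‖ with hd
  have hm0 : 0 ≤ m := by positivity
  have hd0 : 0 ≤ d := by positivity
  set w := m + d + ‖S.B₁‖ + |Cn| with hw
  have hB0 : 0 ≤ ‖S.B₁‖ := S.B₁.opNorm_nonneg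
  have hC0 : 0 ≤ |Cn| := abs_nonneg _
  have k1 : m * V ≤ w * V := mul_le_mul_of_nonneg_right (by linarith) hV
  have k2 : d * (N / ‖l‖) ≤ w * (N / ‖l‖) := mul_le_mul_of_nonneg_right (by linarith) (by positivity)
  have k3 : ‖S.B₁‖ * (b * N / ‖l‖) ≤ w * (b * N / ‖l‖) :=
    mul_le_mul_of_nonneg_right (by linarith) (by positivity)
  have k4 : |Cn| * (b * V) ≤ w * (b * V) := mul_le_mul_of_nonneg_right (by linarith) (by positivity)
  calc _ = m * V + d * (N / ‖l‖) + ‖S.B₁‖ * (b * N / ‖l‖) + |Cn| * (b * V) := by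
        rw [hd]; ring
    _ ≤ _ := by linarith

/-- Bound for the right-hand side of the equation for `z`. -/
theorem IsResolvent.exists_bound_z (S : CoupledForms Vu Vz Hu Hz F) (v₀ : Hu) (e₀ : F) (z₀ : Hz)
    (y₀ : Vz) : ∃ C, 0 ≤ C ∧ ∀ (l : ℂ) (v : Vu × Vu) (z : Vz × Vz),
    S.IsResolvent l v₀ e₀ z₀ y₀ v z →
    ‖l * sesq S.mz (z.map S.jz S.jz) (z.map S.jz S.jz) + sesq S.D z z‖ ≤
    C * (pairNorm (z.map S.jz S.jz) + pairNorm z / ‖l‖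
      + pairNorm (v.map S.E S.E) * pairNorm z / ‖l‖ + pairNorm z ^ 2 / ‖l‖
      + pairNorm (v.map S.ju S.ju) * pairNorm z + pairNorm (z.map S.jz S.jz) * pairNorm z) := by
  obtain ⟨Cn, hCn⟩ := S.n₂_le
  refine ⟨‖S.mz‖ * ‖z₀‖ + (‖S.B₂‖ * ‖e₀‖ + ‖S.K‖ * ‖y₀‖) + ‖S.B₂‖ + ‖S.K‖ + |Cn|
    + (‖S.S₁‖ + ‖S.S₂‖), by positivity, ?_⟩
  intro l v z h
  rw [h.sesq_z]
  set N := pairNorm (v.map S.E S.E)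
  set V := pairNorm (v.map S.ju S.ju)
  set G := pairNorm (z.map S.jz S.jz)
  set b := pairNorm z with hbdef
  have hN : 0 ≤ N := pairNorm_nonneg _
  have hV : 0 ≤ V := pairNorm_nonneg _
  have hG : 0 ≤ G := pairNorm_nonneg _
  have hb : 0 ≤ b := pairNorm_nonneg _
  have t1 : ‖sesq S.mz (z₀, 0) (z.map S.jz S.jz)‖ ≤ ‖S.mz‖ * ‖z₀‖ * G :=
    norm_sesq_prodMk_zero_le _ _ _
  have t2 : ‖sesq S.B₂ (e₀, 0) z‖ ≤ ‖S.B₂‖ * ‖e₀‖ * b :=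
    norm_sesq_prodMk_zero_le _ _ _
  have t3 : ‖sesq S.K (y₀, 0) z‖ ≤ ‖S.K‖ * ‖y₀‖ * b :=
    norm_sesq_prodMk_zero_le _ _ _
  have t4 : ‖sesq S.B₂ (v.map S.E S.E) z‖ ≤ ‖S.B₂‖ * N * b := norm_sesq_le _ _ _
  have t5 : ‖sesq S.K z z‖ ≤ ‖S.K‖ * b * b := norm_sesq_le _ _ _
  have t6 : ‖sesq S.n₂ v z‖ ≤ |Cn| * V * b := by
    refine (norm_sesq_le_of_le (f := fun x => ‖S.ju x‖) (g := fun x => ‖x‖) hCn).trans ?_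
    exact mul_le_mul_of_nonneg_right (mul_le_mul_of_nonneg_right (le_abs_self _) hV) hb
  have t7 : ‖sesq S.S₁ (z.map S.jz S.jz) z‖ ≤ ‖S.S₁‖ * G * b := norm_sesq_le _ _ _
  have t8 : ‖sesq S.S₂ z (z.map S.jz S.jz)‖ ≤ ‖S.S₂‖ * b * G := norm_sesq_le _ _ _
  have hl : 0 ≤ ‖l‖⁻¹ := by positivity
  have e1 : ‖l⁻¹ * (sesq S.B₂ (e₀, 0) z + sesq S.K (y₀, 0) z)‖
      ≤ ‖l‖⁻¹ * (‖S.B₂‖ * ‖e₀‖ * b + ‖S.K‖ * ‖y₀‖ * b) := by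
    rw [norm_mul, norm_inv]
    exact mul_le_mul_of_nonneg_left ((norm_add_le _ _).trans (add_le_add t2 t3)) hl
  have e2 : ‖l⁻¹ * (sesq S.B₂ (v.map S.E S.E) z + sesq S.K z z)‖
      ≤ ‖l‖⁻¹ * (‖S.B₂‖ * N * b + ‖S.K‖ * b * b) := by
    rw [norm_mul, norm_inv]
    exact mul_le_mul_of_nonneg_left ((norm_add_le _ _).trans (add_le_add t4 t5)) hl
  refine (norm_add₃_le).trans ?_
  refine (add_le_add (add_le_add ((norm_add_le _ _).trans (add_le_add ((norm_sub_le _ _).trans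
    (add_le_add ((norm_add_le _ _).trans (add_le_add t1 e1)) e2)) t6)) t7) t8).trans ?_
  set m := ‖S.mz‖ * ‖z₀‖ with hm
  set d := ‖S.B₂‖ * ‖e₀‖ + ‖S.K‖ * ‖y₀‖ with hd
  set s := ‖S.S₁‖ + ‖S.S₂‖ with hs
  have hm0 : 0 ≤ m := by positivity
  have hd0 : 0 ≤ d := by positivity
  have hs0 : 0 ≤ s := by positivity
  set w := m + d + ‖S.B₂‖ + ‖S.K‖ + |Cn| + s with hw
  have hB0 : 0 ≤ ‖S.B₂‖ := S.B₂.opNorm_nonneg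
  have hK0 : 0 ≤ ‖S.K‖ := S.K.opNorm_nonneg
  have hC0 : 0 ≤ |Cn| := abs_nonneg _
  have k1 : m * G ≤ w * G := mul_le_mul_of_nonneg_right (by linarith) hG
  have k2 : d * (b / ‖l‖) ≤ w * (b / ‖l‖) := mul_le_mul_of_nonneg_right (by linarith) (by positivity)
  have k3 : ‖S.B₂‖ * (N * b / ‖l‖) ≤ w * (N * b / ‖l‖) :=
    mul_le_mul_of_nonneg_right (by linarith) (by positivity)
  have k4 : ‖S.K‖ * (b ^ 2 / ‖l‖) ≤ w * (b ^ 2 / ‖l‖) :=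
    mul_le_mul_of_nonneg_right (by linarith) (by positivity)
  have k5 : |Cn| * (V * b) ≤ w * (V * b) := mul_le_mul_of_nonneg_right (by linarith) (by positivity)
  have k6 : s * (G * b) ≤ w * (G * b) := mul_le_mul_of_nonneg_right (by linarith) (by positivity)
  calc _ = m * G + d * (b / ‖l‖) + ‖S.B₂‖ * (N * b / ‖l‖) + ‖S.K‖ * (b ^ 2 / ‖l‖)
        + |Cn| * (V * b) + s * (G * b) := by
        rw [hd, hs]; ring
    _ ≤ _ := by linarith

set_option maxHeartbeats 1000000 in
/-- Resolvent estimate on two rays slightly to the left of the imaginary axis. -/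
theorem exists_resolvent_bound (S : CoupledForms Vu Vz Hu Hz F) :
    ∃ σ κ : ℝ, 0 < σ ∧ 0 < κ ∧ σ ^ 2 + κ ^ 2 = 1 ∧
      ∀ (v₀ : Hu) (e₀ : F) (z₀ : Hz) (y₀ : Vz), ∃ r₀ : ℝ, ∀ (r κ' : ℝ), r₀ ≤ r → |κ'| = κ →
        ∀ (v : Vu × Vu) (z : Vz × Vz), S.IsResolvent (r * ⟨-σ, κ'⟩) v₀ e₀ z₀ y₀ v z →
          pairNorm (v.map S.ju S.ju) ≤ 1 ∧ pairNorm (z.map S.jz S.jz) ≤ 1 := by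
  obtain ⟨ρ, hρ, hmu⟩ := S.mu_pos
  obtain ⟨ρz, hρz, hmz⟩ := S.mz_pos
  obtain ⟨c, hc, hA⟩ := S.A_pos
  obtain ⟨c₁, hc₁, C₁, hD⟩ := S.D_pos
  -- The angle to the imaginary axis: small against the ratio of coercivity to size of the damping,
  -- so that σ‖D‖ ≤ c₁ / 8. The bound 1 / 2 keeps κ ≥ 1 / 2.
  set σ := min (1 / 2) (c₁ / (8 * (‖S.D‖ + 1))) with hσdef
  have hσ : 0 < σ := lt_min (by norm_num) (by positivity)
  have hσ2 : σ ≤ 1 / 2 := min_le_left _ _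
  have hσD : σ * ‖S.D‖ ≤ c₁ / 8 := by
    have h1 : σ * (8 * (‖S.D‖ + 1)) ≤ c₁ :=
      (le_div_iff₀ (by positivity)).1 (min_le_right (1 / 2) (c₁ / (8 * (‖S.D‖ + 1))))
    linarith
  have hκ0 : 0 < 1 - σ ^ 2 := by nlinarith
  set κ := √(1 - σ ^ 2) with hκdef
  have hκ : 0 < κ := Real.sqrt_pos.2 hκ0
  have hκsq : κ ^ 2 = 1 - σ ^ 2 := Real.sq_sqrt hκ0.le
  have hκ2 : 1 / 2 ≤ κ := by
    by_contra! h
    nlinarith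
  refine ⟨σ, κ, hσ, hκ, by linarith, fun v₀ e₀ z₀ y₀ => ?_⟩
  obtain ⟨Cu, hCu, hbu⟩ := IsResolvent.exists_bound_u S v₀ e₀ z₀ y₀
  obtain ⟨Cz, hCz, hbz⟩ := IsResolvent.exists_bound_z S v₀ e₀ z₀ y₀
  set γ := min (ρ / 2) (c / 2) with hγ
  have hγ0 : 0 < γ := lt_min (by positivity) (by positivity)
  set K₁ := Cu / (σ * γ) with hK₁
  set P := (2 * (‖S.D‖ + Cz + 1)) / (ρz / 2) with hP
  set Q := (|C₁| + 2 * Cz) / (c₁ / 4) with hQ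
  have hQ0 : 0 ≤ Q := by positivity
  have hP0 : 0 ≤ P := by positivity
  set K₂ := Q + P * (Q + 1) with hK₂
  have hK₁0 : 0 ≤ K₁ := by positivity
  have hK₂0 : 0 ≤ K₂ := by positivity
  -- The threshold required by `le_one_of_weighted_bounds`; it depends on the data through K₁ and
  -- K₂, whereas σ and κ do not.
  refine ⟨max 1 ((64 * (K₁ + K₂)) ^ 2), ?_⟩
  intro r κ' hr hκ' v z h
  have hr1 : 1 ≤ r := (le_max_left _ _).trans hr
  have hr2 : (64 * (K₁ + K₂)) ^ 2 ≤ r := (le_max_right _ _).trans hr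
  have hr0 : 0 < r := by linarith
  have hbu := hbu _ v z h
  have hbz := hbz _ v z h
  set l : ℂ := r * ⟨-σ, κ'⟩ with hl
  have hκ'sq : κ' ^ 2 = κ ^ 2 := by rw [← hκ', sq_abs]
  have hw : ‖(⟨-σ, κ'⟩ : ℂ)‖ = 1 := by
    rw [Complex.norm_def, Complex.normSq_apply, Real.sqrt_eq_one]
    simp only
    linarith
  have hln : ‖l‖ = r := by
    rw [hl, norm_mul, hw, Complex.norm_real, Real.norm_of_nonneg hr0.le, mul_one]
  have hlre : l.re = -(r * σ) := by simp [hl]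
  -- Re l and Re l⁻¹ have the same sign, so kinetic and elastic energy add up instead of competing.
  have hlinv : (l⁻¹).re = -(σ / r) := by
    rw [Complex.inv_re, Complex.normSq_eq_norm_sq, hln, hlre]
    field_simp
  rw [hln] at hbu hbz
  rw [sesq_self_of_symm S.mu_symm] at hbu
  rw [sesq_self_of_symm S.mz_symm] at hbz
  -- The stiffness is assumed symmetric only on the range of the strain, so `sesq_self_of_symm` does
  -- not apply directly.
  have hAs : sesq S.A (v.map S.E S.E) (v.map S.E S.E)
      = ((S.A (S.E v.1) (S.E v.1) + S.A (S.E v.2) (S.E v.2) : ℝ) : ℂ) := by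
    apply Complex.ext
    · rw [sesq_re, Complex.ofReal_re]; rfl
    · simp [sesq, cval, S.A_symm v.2 v.1]
  rw [hAs] at hbu
  simp only [Prod.map_fst, Prod.map_snd] at hbu hbz
  set N := pairNorm (v.map S.E S.E) with hNdef
  set V := pairNorm (v.map S.ju S.ju) with hVdef
  set G := pairNorm (z.map S.jz S.jz) with hGdef
  set b := pairNorm z with hbdef
  have hN : 0 ≤ N := pairNorm_nonneg _
  have hV : 0 ≤ V := pairNorm_nonneg _
  have hG : 0 ≤ G := pairNorm_nonneg _
  have hb : 0 ≤ b := pairNorm_nonneg _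
  have hN2 : N ^ 2 ≤ 2 * (‖S.E v.1‖ ^ 2 + ‖S.E v.2‖ ^ 2) := sq_pairNorm_le _
  have hV2 : V ^ 2 ≤ 2 * (‖S.ju v.1‖ ^ 2 + ‖S.ju v.2‖ ^ 2) := sq_pairNorm_le _
  have hG2 : G ^ 2 ≤ 2 * (‖S.jz z.1‖ ^ 2 + ‖S.jz z.2‖ ^ 2) := sq_pairNorm_le _
  have hb2 : b ^ 2 ≤ 2 * (‖z.1‖ ^ 2 + ‖z.2‖ ^ 2) := sq_pairNorm_le _
  have hG3 : ‖S.jz z.1‖ ^ 2 + ‖S.jz z.2‖ ^ 2 ≤ G ^ 2 := by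
    simp only [hGdef, pairNorm, Prod.map_fst, Prod.map_snd]
    have := mul_nonneg (norm_nonneg (S.jz z.1)) (norm_nonneg (S.jz z.2))
    linarith [add_sq ‖S.jz z.1‖ ‖S.jz z.2‖]
  set X := S.mu (S.ju v.1) (S.ju v.1) + S.mu (S.ju v.2) (S.ju v.2) with hX
  set a := S.A (S.E v.1) (S.E v.1) + S.A (S.E v.2) (S.E v.2) with ha
  set Z := S.mz (S.jz z.1) (S.jz z.1) + S.mz (S.jz z.2) (S.jz z.2) with hZ
  have hXV : ρ / 2 * V ^ 2 ≤ X := by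
    have := hmu (S.ju v.1)
    have := hmu (S.ju v.2)
    have := mul_le_mul_of_nonneg_left hV2 (half_pos hρ).le
    linarith
  have haN : c / 2 * N ^ 2 ≤ a := by
    have := hA v.1
    have := hA v.2
    have := mul_le_mul_of_nonneg_left hN2 (half_pos hc).le
    linarith
  have hZG : ρz / 2 * G ^ 2 ≤ Z := by
    have := hmz (S.jz z.1)
    have := hmz (S.jz z.2)
    have := mul_le_mul_of_nonneg_left hG2 (half_pos hρz).le
    linarith
  -- The damping is not assumed symmetric; only its real part is coercive, up to a pivot term.
  have hDre : c₁ / 2 * b ^ 2 - |C₁| * G ^ 2 ≤ (sesq S.D z z).re := by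
    rw [sesq_re]
    have := hD z.1
    have := hD z.2
    have h1 : C₁ * (‖S.jz z.1‖ ^ 2 + ‖S.jz z.2‖ ^ 2) ≤ |C₁| * G ^ 2 :=
      (mul_le_mul_of_nonneg_right (le_abs_self _) (by positivity)).trans
        (mul_le_mul_of_nonneg_left hG3 (abs_nonneg _))
    have := mul_le_mul_of_nonneg_left hb2 (half_pos hc₁).le
    linarith
  have hDn : ‖sesq S.D z z‖ ≤ ‖S.D‖ * b ^ 2 := by
    rw [sq, ← mul_assoc]
    exact norm_sesq_le _ _ _
  -- the equation for `u`
  have hu : σ * (r * X + a / r) ≤ Cu * (b * N / r + b * V + V + N / r) := by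
    refine le_trans ?_ hbu
    refine le_trans ?_ ((neg_le_abs _).trans (Complex.abs_re_le_norm _))
    rw [Complex.add_re, Complex.re_mul_ofReal, Complex.re_mul_ofReal, hlre, hlinv]
    apply le_of_eq
    ring
  have hu1 : r * V ^ 2 + N ^ 2 / r ≤ K₁ * (b * N / r + b * V + V + N / r) := by
    have k1 : γ * V ^ 2 ≤ X := (mul_le_mul_of_nonneg_right (min_le_left _ _) (sq_nonneg _)).trans hXV
    have k2 : γ * N ^ 2 ≤ a :=
      (mul_le_mul_of_nonneg_right (min_le_right _ _) (sq_nonneg _)).trans haN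
    have k3 : r * (γ * V ^ 2) ≤ r * X := mul_le_mul_of_nonneg_left k1 hr0.le
    have k4 : γ * N ^ 2 / r ≤ a / r := div_le_div_of_nonneg_right k2 hr0.le
    have k5 : σ * (r * (γ * V ^ 2) + γ * N ^ 2 / r) ≤ σ * (r * X + a / r) :=
      mul_le_mul_of_nonneg_left (add_le_add k3 k4) hσ.le
    rw [hK₁, div_mul_eq_mul_div, le_div_iff₀ (by positivity)]
    calc _ = σ * (r * (γ * V ^ 2) + γ * N ^ 2 / r) := by ring
      _ ≤ _ := k5.trans hu
  -- the equation for `z`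
  set W := G + b / r + N * b / r + b ^ 2 / r + V * b + G * b with hW
  have hW0 : 0 ≤ W := by positivity
  have hz1 : c₁ / 2 * b ^ 2 - |C₁| * G ^ 2 - r * σ * Z ≤ Cz * W := by
    refine le_trans ?_ hbz
    refine le_trans ?_ ((le_abs_self _).trans (Complex.abs_re_le_norm _))
    rw [Complex.add_re, Complex.re_mul_ofReal, hlre]
    linarith
  -- In the real part the inertia -rσZ has the unfavourable sign. The modulus of the equation bounds
  -- rZ by the right side and the size of the damping.
  have hz2 : r * Z * κ ≤ Cz * W + ‖S.D‖ * b ^ 2 := by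
    have k0 : 0 ≤ Z := le_trans (by positivity) hZG
    have k1 : ‖l * (Z : ℂ)‖ ≤ Cz * W + ‖S.D‖ * b ^ 2 := by
      calc ‖l * (Z : ℂ)‖ = ‖l * (Z : ℂ) + sesq S.D z z - sesq S.D z z‖ := by ring_nf
        _ ≤ _ := (norm_sub_le _ _).trans (add_le_add hbz hDn)
    refine le_trans ?_ k1
    rw [norm_mul, hln, Complex.norm_real, Real.norm_of_nonneg k0]
    have : κ ≤ 1 := Real.sqrt_le_one.2 (by linarith [sq_nonneg σ])
    exact mul_le_of_le_one_right (by positivity) this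
  have hz3 : r * Z ≤ 2 * (Cz * W + ‖S.D‖ * b ^ 2) := by
    have k0 : 0 ≤ r * Z := mul_nonneg hr0.le (le_trans (by positivity) hZG)
    have := mul_le_mul_of_nonneg_left hκ2 k0
    linarith
  -- The bound on rZ is inserted with its factor σ: the resulting 2σ‖D‖b² is at most c₁b² / 4, half
  -- of the coercive term.
  have hz4 : b ^ 2 ≤ Q * (G ^ 2 + W) := by
    have k1 : σ * (r * Z) ≤ σ * (2 * (Cz * W + ‖S.D‖ * b ^ 2)) :=
      mul_le_mul_of_nonneg_left hz3 hσ.le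
    have k2 : σ * ‖S.D‖ * b ^ 2 ≤ c₁ / 8 * b ^ 2 := mul_le_mul_of_nonneg_right hσD (sq_nonneg _)
    have k3 : σ * (Cz * W) ≤ 1 / 2 * (Cz * W) := mul_le_mul_of_nonneg_right hσ2 (by positivity)
    have k4 : c₁ / 4 * b ^ 2 ≤ |C₁| * G ^ 2 + 2 * Cz * W := by linarith
    have k5 : 0 ≤ |C₁| * W := by positivity
    have k6 : 0 ≤ 2 * Cz * G ^ 2 := by positivity
    rw [hQ, div_mul_eq_mul_div, le_div_iff₀ (by positivity)]
    linarith
  have hz5 : r * G ^ 2 ≤ P * (W + b ^ 2) := by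
    rw [hP, div_mul_eq_mul_div, le_div_iff₀ (by positivity)]
    have k1 : r * (ρz / 2 * G ^ 2) ≤ r * Z := mul_le_mul_of_nonneg_left hZG hr0.le
    have k2 : 0 ≤ Cz * b ^ 2 := by positivity
    have k3 : 0 ≤ ‖S.D‖ * W := by positivity
    have k4 : 0 ≤ b ^ 2 := by positivity
    linarith
  have hz6 : b ^ 2 + r * G ^ 2 ≤ K₂ * (G ^ 2 + W) := by
    have k1 : P * b ^ 2 ≤ P * (Q * (G ^ 2 + W)) := mul_le_mul_of_nonneg_left hz4 hP0
    have k2 : 0 ≤ P * G ^ 2 := by positivity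
    rw [hK₂]
    linarith
  have hz7 : K₂ * (G ^ 2 + W)
      ≤ (K₁ + K₂) * (G ^ 2 + G + b / r + N * b / r + b ^ 2 / r + V * b + G * b) := by
    have : 0 ≤ K₁ * (G ^ 2 + W) := by positivity
    rw [hW] at this ⊢
    linarith
  refine le_one_of_weighted_bounds (K := K₁ + K₂) (by positivity) hr1 hr2 hV hN hG hb
    (hu1.trans ?_) (hz6.trans hz7)
  exact mul_le_mul_of_nonneg_right (by linarith) (by positivity)

end CoupledForms

end TypeIII

/-! ### The finite Laplace transform. -/

namespace TypeIII

/-- The kernel of the finite Laplace transform. -/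
noncomputable def lapKernel (T : ℝ) (l : ℂ) (t : ℝ) : ℂ := Complex.exp (-(l * (T - t)))

/-- The finite Laplace transform of `g` on `[0, T]`, normalised at the end point `T`. -/
noncomputable def lap (T : ℝ) (g : ℝ → ℝ) (l : ℂ) : ℂ :=
  ∫ t in (0 : ℝ)..T, lapKernel T l t * (g t : ℂ)

/-- Real and imaginary part of the finite Laplace transform of a vector-valued function. -/
noncomputable def lapPair {X : Type*} [NormedAddCommGroup X] [NormedSpace ℝ X] (T : ℝ)
    (f : ℝ → X) (l : ℂ) : X × X :=
  (∫ t in (0 : ℝ)..T, (lapKernel T l t).re • f t, ∫ t in (0 : ℝ)..T, (lapKernel T l t).im • f t)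

theorem continuous_lapKernel (T : ℝ) (l : ℂ) : Continuous (lapKernel T l) := by
  unfold lapKernel
  fun_prop

theorem norm_lapKernel (T : ℝ) (l : ℂ) (t : ℝ) :
    ‖lapKernel T l t‖ = Real.exp (-(l.re * (T - t))) := by
  rw [lapKernel, Complex.norm_exp]
  congr 1
  rw [← Complex.ofReal_sub, Complex.neg_re, Complex.re_mul_ofReal]

theorem hasDerivAt_lapKernel (T : ℝ) (l : ℂ) (t : ℝ) :
    HasDerivAt (lapKernel T l) (l * lapKernel T l t) t := by
  have h1 : HasDerivAt (fun z : ℂ => Complex.exp (-(l * (T - z)))) (l * lapKernel T l t) (t : ℂ) := by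
    have := ((((hasDerivAt_id (t : ℂ)).const_sub (T : ℂ)).const_mul l).neg).cexp
    refine this.congr_deriv ?_
    simp [lapKernel, mul_comm]
  exact h1.comp_ofReal

variable {T : ℝ} {g g₁ g₂ : ℝ → ℝ}

theorem intervalIntegrable_lap (hT : 0 ≤ T) (hg : ContinuousOn g (Icc 0 T)) (l : ℂ) :
    IntervalIntegrable (fun t => lapKernel T l t * (g t : ℂ)) volume 0 T := by
  refine ContinuousOn.intervalIntegrable ?_
  rw [uIcc_of_le hT]
  exact (continuous_lapKernel T l).continuousOn.mul
    (Complex.continuous_ofReal.comp_continuousOn hg)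

theorem lap_add (hT : 0 ≤ T) (h₁ : ContinuousOn g₁ (Icc 0 T)) (h₂ : ContinuousOn g₂ (Icc 0 T))
    (l : ℂ) : lap T (fun t => g₁ t + g₂ t) l = lap T g₁ l + lap T g₂ l := by
  simp only [lap, Complex.ofReal_add, mul_add]
  exact intervalIntegral.integral_add (intervalIntegrable_lap hT h₁ l)
    (intervalIntegrable_lap hT h₂ l)

theorem lap_sub (hT : 0 ≤ T) (h₁ : ContinuousOn g₁ (Icc 0 T)) (h₂ : ContinuousOn g₂ (Icc 0 T))
    (l : ℂ) : lap T (fun t => g₁ t - g₂ t) l = lap T g₁ l - lap T g₂ l := by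
  simp only [lap, Complex.ofReal_sub, mul_sub]
  exact intervalIntegral.integral_sub (intervalIntegrable_lap hT h₁ l)
    (intervalIntegrable_lap hT h₂ l)

theorem lap_eq_zero (hT : 0 ≤ T) (h : ∀ t, 0 < t → g t = 0) (l : ℂ) : lap T g l = 0 := by
  refine intervalIntegral.integral_zero_ae (Filter.Eventually.of_forall fun t ht => ?_)
  rw [uIoc_of_le hT] at ht
  rw [h t ht.1, Complex.ofReal_zero, mul_zero]

/-- Integration by parts: the kernel has derivative l times itself and equals 1 at `T`, and the
boundary term at 0 vanishes with g. The state at `T` is thus the only data of the transformed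
equations. -/
theorem lap_deriv {g' : ℝ → ℝ} (hT : 0 ≤ T)
    (hd : ∀ t, 0 ≤ t → HasDerivWithinAt g (g' t) (Ici 0) t)
    (hg' : ContinuousOn g' (Icc 0 T)) (h0 : g 0 = 0) (l : ℂ) :
    lap T g' l = (g T : ℂ) - l * lap T g l := by
  have hgc : ContinuousOn g (Icc 0 T) := fun t ht =>
    ((hd t ht.1).continuousWithinAt).mono Icc_subset_Ici_self
  have hder : ∀ t, 0 ≤ t → HasDerivWithinAt (fun t => lapKernel T l t * (g t : ℂ))
      (l * lapKernel T l t * (g t : ℂ) + lapKernel T l t * (g' t : ℂ)) (Ici 0) t := fun t ht =>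
    (hasDerivAt_lapKernel T l t).hasDerivWithinAt.mul (hd t ht).ofReal_comp
  have hi := intervalIntegrable_lap hT hgc l
  have hi' := intervalIntegrable_lap hT hg' l
  have hi2 : IntervalIntegrable (fun t => l * lapKernel T l t * (g t : ℂ)) volume 0 T := by
    simpa [mul_assoc] using hi.const_mul l
  have := intervalIntegral.integral_eq_sub_of_hasDeriv_right
    (f := fun t => lapKernel T l t * (g t : ℂ))
    (f' := fun t => l * lapKernel T l t * (g t : ℂ) + lapKernel T l t * (g' t : ℂ)) (a := 0) (b := T)
    (by
      rw [uIcc_of_le hT]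
      exact (continuous_lapKernel T l).continuousOn.mul
        (Complex.continuous_ofReal.comp_continuousOn hgc))
    (fun t ht => by
      rw [min_eq_left hT] at ht
      exact (hder t ht.1.le).mono (Ioi_subset_Ici ht.1.le))
    (hi2.add hi')
  rw [intervalIntegral.integral_add hi2 hi', h0] at this
  simp only [mul_assoc, intervalIntegral.integral_const_mul] at this
  simp only [lap]
  have hk : lapKernel T l T = 1 := by simp [lapKernel]
  rw [hk] at this
  simp only [Complex.ofReal_zero, mul_zero, one_mul, sub_zero] at this
  linear_combination this

/-- The kernel has modulus exp(-Re l (T - t)) with 0 ≤ T - t ≤ T: at most exp(T‖l‖) everywhere, and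
at most 1 on the right half plane. -/
theorem exists_norm_lap_le (hT : 0 ≤ T) (hg : ContinuousOn g (Icc 0 T)) :
    ∃ C, 0 ≤ C ∧ (∀ l, ‖lap T g l‖ ≤ C * Real.exp (T * ‖l‖)) ∧ ∀ l : ℂ, 0 ≤ l.re → ‖lap T g l‖ ≤ C := by
  obtain ⟨B, hB⟩ := isCompact_Icc.exists_bound_of_continuousOn hg
  have hB0 : 0 ≤ B := (norm_nonneg _).trans (hB 0 ⟨le_rfl, hT⟩)
  refine ⟨B * T, by positivity, fun l => ?_, fun l hl => ?_⟩
  · have : ∀ t ∈ uIoc 0 T, ‖lapKernel T l t * (g t : ℂ)‖ ≤ Real.exp (T * ‖l‖) * B := by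
      intro t ht
      rw [uIoc_of_le hT] at ht
      rw [norm_mul, norm_lapKernel, Complex.norm_real]
      refine mul_le_mul (Real.exp_le_exp.2 ?_) (hB t ⟨ht.1.le, ht.2⟩) (norm_nonneg _)
        (Real.exp_pos _).le
      have h1 : -(l.re * (T - t)) ≤ ‖l‖ * (T - t) := by
        rw [← neg_mul]
        exact mul_le_mul_of_nonneg_right ((neg_le_abs _).trans (Complex.abs_re_le_norm l))
          (by linarith [ht.2])
      have h2 : ‖l‖ * (T - t) ≤ ‖l‖ * T :=
        mul_le_mul_of_nonneg_left (by linarith [ht.1]) (norm_nonneg _)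
      linarith
    refine (intervalIntegral.norm_integral_le_of_norm_le_const this).trans (le_of_eq ?_)
    rw [sub_zero, abs_of_nonneg hT]
    ring
  · have : ∀ t ∈ uIoc 0 T, ‖lapKernel T l t * (g t : ℂ)‖ ≤ B := by
      intro t ht
      rw [uIoc_of_le hT] at ht
      rw [norm_mul, norm_lapKernel, Complex.norm_real]
      refine (mul_le_of_le_one_left (norm_nonneg _) (Real.exp_le_one_iff.2 ?_)).trans
        (hB t ⟨ht.1.le, ht.2⟩)
      have := mul_nonneg hl (sub_nonneg.2 ht.2)
      linarith
    refine (intervalIntegral.norm_integral_le_of_norm_le_const this).trans (le_of_eq ?_)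
    rw [sub_zero, abs_of_nonneg hT]

theorem differentiable_lap (hT : 0 ≤ T) (hg : ContinuousOn g (Icc 0 T)) :
    Differentiable ℂ (lap T g) := by
  intro l₀
  obtain ⟨B, hB⟩ := isCompact_Icc.exists_bound_of_continuousOn hg
  have hc : ContinuousOn (fun t : ℝ => -((T : ℂ) - t) * lapKernel T l₀ t * (g t : ℂ)) (Icc 0 T) :=
    ((Continuous.mul (by fun_prop) (continuous_lapKernel T l₀)).continuousOn).mul
      (Complex.continuous_ofReal.comp_continuousOn hg)
  have := intervalIntegral.hasDerivAt_integral_of_dominated_loc_of_deriv_le (𝕜 := ℂ) (μ := volume)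
    (a := 0) (b := T) (F := fun l t => lapKernel T l t * (g t : ℂ))
    (F' := fun l t => -((T : ℂ) - t) * lapKernel T l t * (g t : ℂ)) (x₀ := l₀)
    (s := Metric.ball l₀ 1) (bound := fun _ => T * Real.exp (T * (‖l₀‖ + 1)) * B)
    (Metric.ball_mem_nhds l₀ one_pos)
    (Filter.Eventually.of_forall fun l => by
      rw [uIoc_of_le hT]
      exact ((intervalIntegrable_iff_integrableOn_Ioc_of_le hT).1
        (intervalIntegrable_lap hT hg l)).aestronglyMeasurable)
    (intervalIntegrable_lap hT hg l₀)
    (by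
      rw [uIoc_of_le hT]
      exact (hc.mono Ioc_subset_Icc_self).aestronglyMeasurable measurableSet_Ioc)
    (Filter.Eventually.of_forall fun t ht l hl => ?_)
    intervalIntegrable_const
    (Filter.Eventually.of_forall fun t ht l hl => ?_)
  · exact this.2.differentiableAt
  · rw [uIoc_of_le hT] at ht
    rw [norm_mul, norm_mul, norm_lapKernel, Complex.norm_real, norm_neg, ← Complex.ofReal_sub,
      Complex.norm_real, Real.norm_of_nonneg (sub_nonneg.2 ht.2)]
    have h0 : 0 ≤ T - t := sub_nonneg.2 ht.2
    have hl1 : ‖l‖ ≤ ‖l₀‖ + 1 := by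
      have := mem_ball_iff_norm.1 hl
      have := norm_le_norm_add_norm_sub' l l₀
      linarith
    have h1 : -(l.re * (T - t)) ≤ ‖l‖ * (T - t) := by
      rw [← neg_mul]
      exact mul_le_mul_of_nonneg_right ((neg_le_abs _).trans (Complex.abs_re_le_norm l)) h0
    have h2 : ‖l‖ * (T - t) ≤ (‖l₀‖ + 1) * T :=
      mul_le_mul hl1 (by linarith [ht.1]) h0 (by positivity)
    refine mul_le_mul (mul_le_mul (by linarith [ht.1]) (Real.exp_le_exp.2 (by linarith))
      (Real.exp_pos _).le hT) (hB t ⟨ht.1.le, ht.2⟩) (norm_nonneg _) (by positivity)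
  · refine HasDerivAt.mul_const ?_ _
    have := (((hasDerivAt_id l).mul_const ((T : ℂ) - t)).neg).cexp
    refine this.congr_deriv ?_
    simp [lapKernel, mul_comm]

theorem tendsto_lap_atTop (hT : 0 ≤ T) (hg : ContinuousOn g (Icc 0 T)) :
    Filter.Tendsto (fun r : ℝ => lap T g r) Filter.atTop (nhds 0) := by
  obtain ⟨B, hB⟩ := isCompact_Icc.exists_bound_of_continuousOn hg
  have : Filter.Tendsto (fun r : ℝ => lap T g r) Filter.atTop
      (nhds (∫ _ in (0 : ℝ)..T, (0 : ℂ))) := by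
    refine intervalIntegral.tendsto_integral_filter_of_dominated_convergence (fun _ => B)
      (Filter.Eventually.of_forall fun r => ?_) ?_ intervalIntegrable_const ?_
    · rw [uIoc_of_le hT]
      exact ((intervalIntegrable_iff_integrableOn_Ioc_of_le hT).1
        (intervalIntegrable_lap hT hg r)).aestronglyMeasurable
    · filter_upwards [Filter.eventually_ge_atTop 0] with r hr
      refine Filter.Eventually.of_forall fun t ht => ?_
      rw [uIoc_of_le hT] at ht
      rw [norm_mul, norm_lapKernel, Complex.norm_real]
      refine (mul_le_of_le_one_left (norm_nonneg _) (Real.exp_le_one_iff.2 ?_)).trans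
        (hB t ⟨ht.1.le, ht.2⟩)
      have := mul_nonneg hr (sub_nonneg.2 ht.2)
      simpa using this
    -- At t = T the kernel is 1 for every r; elsewhere it decays.
    · have hae : ∀ᵐ t : ℝ, t ≠ T := by simp [ae_iff]
      filter_upwards [hae] with t htT ht
      rw [uIoc_of_le hT] at ht
      have hlt : 0 < T - t := sub_pos.2 (lt_of_le_of_ne ht.2 htT)
      rw [← zero_mul (g t : ℂ)]
      refine Filter.Tendsto.mul_const _ ?_
      rw [tendsto_zero_iff_norm_tendsto_zero]
      simp only [norm_lapKernel, Complex.ofReal_re]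
      exact Real.tendsto_exp_neg_atTop_nhds_zero.comp (Filter.tendsto_id.atTop_mul_const hlt)
  simpa using this

/-- Functionals commute with the vector-valued integral. This identifies scalar transforms of the
equation with `cval` at the complex vector `lapPair`. -/
theorem lap_comp {X : Type*} [NormedAddCommGroup X] [NormedSpace ℝ X] [CompleteSpace X]
    (hT : 0 ≤ T) {f : ℝ → X} (hf : ContinuousOn f (Icc 0 T)) (L : X →L[ℝ] ℝ) (l : ℂ) :
    lap T (fun t => L (f t)) l = ⟨L (lapPair T f l).1, L (lapPair T f l).2⟩ := by
  have hi := intervalIntegrable_lap (g := fun t => L (f t)) hT (L.continuous.comp_continuousOn hf) l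
  have h1 : IntervalIntegrable (fun t => (lapKernel T l t).re • f t) volume 0 T := by
    refine ContinuousOn.intervalIntegrable ?_
    rw [uIcc_of_le hT]
    exact (Complex.continuous_re.comp (continuous_lapKernel T l)).continuousOn.smul hf
  have h2 : IntervalIntegrable (fun t => (lapKernel T l t).im • f t) volume 0 T := by
    refine ContinuousOn.intervalIntegrable ?_
    rw [uIcc_of_le hT]
    exact (Complex.continuous_im.comp (continuous_lapKernel T l)).continuousOn.smul hf
  apply Complex.ext
  · simp only [lapPair]
    rw [← L.intervalIntegral_comp_comm h1, lap, ← Complex.reCLM_apply,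
      ← Complex.reCLM.intervalIntegral_comp_comm hi]
    refine intervalIntegral.integral_congr fun t _ => ?_
    simp
  · simp only [lapPair]
    rw [← L.intervalIntegral_comp_comm h2, lap, ← Complex.imCLM_apply,
      ← Complex.imCLM.intervalIntegral_comp_comm hi]
    refine intervalIntegral.integral_congr fun t _ => ?_
    simp

/-! ### Uniqueness for the abstract system. -/

namespace CoupledForms

variable {Vu Vz Hu Hz F : Type*}
    [NormedAddCommGroup Vu] [NormedSpace ℝ Vu] [NormedAddCommGroup Vz] [NormedSpace ℝ Vz]
    [NormedAddCommGroup Hu] [NormedSpace ℝ Hu] [NormedAddCommGroup Hz] [NormedSpace ℝ Hz]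
    [NormedAddCommGroup F] [NormedSpace ℝ F]

/-- `(u, y)` with velocities `(v, z)` and accelerations `(v', z')` is a solution with null data of
the evolution equation defined by the forms `S`. -/
structure IsNullSolution (S : CoupledForms Vu Vz Hu Hz F) (u v : ℝ → Vu) (y z : ℝ → Vz)
    (v' : ℝ → Hu) (z' : ℝ → Hz) : Prop where
  cont_v : ContinuousOn v (Ici 0)
  cont_z : ContinuousOn z (Ici 0)
  cont_v' : ContinuousOn v' (Ici 0)
  cont_z' : ContinuousOn z' (Ici 0)
  deriv_u : ∀ t, 0 ≤ t → HasDerivWithinAt u (v t) (Ici 0) t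
  deriv_y : ∀ t, 0 ≤ t → HasDerivWithinAt y (z t) (Ici 0) t
  deriv_v : ∀ t, 0 ≤ t → HasDerivWithinAt (fun t => S.ju (v t)) (v' t) (Ici 0) t
  deriv_z : ∀ t, 0 ≤ t → HasDerivWithinAt (fun t => S.jz (z t)) (z' t) (Ici 0) t
  init_u : u 0 = 0
  init_y : y 0 = 0
  init_v : S.ju (v 0) = 0
  init_z : S.jz (z 0) = 0
  eq_u : ∀ t, 0 < t → ∀ φ, S.mu (v' t) (S.ju φ) + S.A (S.E (u t)) (S.E φ) + S.B₁ (y t) (S.E φ)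
    + S.n₁ (z t) φ = 0
  eq_z : ∀ t, 0 < t → ∀ ψ, S.mz (z' t) (S.jz ψ) + S.B₂ (S.E (u t)) ψ + S.K (y t) ψ
    + S.n₂ (v t) ψ + S.S₁ (S.jz (z t)) ψ + S.S₂ (z t) (S.jz ψ) - S.D (z t) ψ = 0

variable {S : CoupledForms Vu Vz Hu Hz F} {u v : ℝ → Vu} {y z : ℝ → Vz}
    {v' : ℝ → Hu} {z' : ℝ → Hz}

theorem lap_deriv_clm {X : Type*} [NormedAddCommGroup X] [NormedSpace ℝ X] {f f' : ℝ → X}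
    (hT : 0 ≤ T) (hd : ∀ t, 0 ≤ t → HasDerivWithinAt f (f' t) (Ici 0) t)
    (hf' : ContinuousOn f' (Ici 0)) (h0 : f 0 = 0) (L : X →L[ℝ] ℝ) (l : ℂ) :
    lap T (fun t => L (f' t)) l = (L (f T) : ℂ) - l * lap T (fun t => L (f t)) l :=
  lap_deriv hT (g := fun t => L (f t)) (g' := fun t => L (f' t))
    (fun t ht => L.hasFDerivAt.comp_hasDerivWithinAt t (hd t ht))
    (L.continuous.comp_continuousOn (hf'.mono Icc_subset_Ici_self)) (by rw [h0, map_zero]) l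

theorem cval_prodMk_zero {X Y : Type*} [NormedAddCommGroup X] [NormedSpace ℝ X]
    [NormedAddCommGroup Y] [NormedSpace ℝ Y] (b : X →L[ℝ] Y →L[ℝ] ℝ) (x : X) (y : Y) :
    cval b (x, 0) y = (b x y : ℂ) := by
  apply Complex.ext <;> simp [cval]

variable [CompleteSpace Vu] [CompleteSpace Vz]

/-- The equations are transformed term by term. Accelerations are reduced to velocities by
`lap_deriv_clm`, and positions are eliminated by the same identity solved for the transform of the
position; this is the origin of l⁻¹ and of l ≠ 0. -/
theorem IsNullSolution.isResolvent (h : S.IsNullSolution u v y z v' z') (hT : 0 ≤ T) {l : ℂ}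
    (hl : l ≠ 0) :
    S.IsResolvent l (S.ju (v T)) (S.E (u T)) (S.jz (z T)) (y T) (lapPair T v l)
      (lapPair T z l) := by
  have hv : ContinuousOn v (Icc 0 T) := h.cont_v.mono Icc_subset_Ici_self
  have hz : ContinuousOn z (Icc 0 T) := h.cont_z.mono Icc_subset_Ici_self
  have hv' : ContinuousOn v' (Icc 0 T) := h.cont_v'.mono Icc_subset_Ici_self
  have hz' : ContinuousOn z' (Icc 0 T) := h.cont_z'.mono Icc_subset_Ici_self
  have hu : ContinuousOn u (Icc 0 T) := fun t ht =>
    (h.deriv_u t ht.1).continuousWithinAt.mono Icc_subset_Ici_self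
  have hy : ContinuousOn y (Icc 0 T) := fun t ht =>
    (h.deriv_y t ht.1).continuousWithinAt.mono Icc_subset_Ici_self
  have hjv := S.ju.continuous.comp_continuousOn hv
  have hjz := S.jz.continuous.comp_continuousOn hz
  have hEu := S.E.continuous.comp_continuousOn hu
  constructor
  · intro φ
    have c1 : ContinuousOn (fun t => S.mu (v' t) (S.ju φ)) (Icc 0 T) :=
      (S.mu.flip (S.ju φ)).continuous.comp_continuousOn hv'
    have c2 : ContinuousOn (fun t => S.A (S.E (u t)) (S.E φ)) (Icc 0 T) :=
      (S.A.flip (S.E φ)).continuous.comp_continuousOn hEu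
    have c3 : ContinuousOn (fun t => S.B₁ (y t) (S.E φ)) (Icc 0 T) :=
      (S.B₁.flip (S.E φ)).continuous.comp_continuousOn hy
    have c4 : ContinuousOn (fun t => S.n₁ (z t) φ) (Icc 0 T) :=
      (S.n₁.flip φ).continuous.comp_continuousOn hz
    have e := lap_eq_zero hT (fun t ht => h.eq_u t ht φ) l
    rw [lap_add hT ((c1.fun_add c2).fun_add c3) c4, lap_add hT (c1.fun_add c2) c3, lap_add hT c1 c2] at e
    have d1 := lap_deriv_clm hT h.deriv_v h.cont_v' h.init_v (S.mu.flip (S.ju φ)) l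
    have d2 := lap_deriv_clm hT h.deriv_u h.cont_v h.init_u ((S.A.flip (S.E φ)).comp S.E) l
    have d3 := lap_deriv_clm hT h.deriv_y h.cont_z h.init_y (S.B₁.flip (S.E φ)) l
    have p1 := lap_comp hT hv ((S.mu.flip (S.ju φ)).comp S.ju) l
    have p2 := lap_comp hT hv ((S.A.flip (S.E φ)).comp S.E) l
    have p3 := lap_comp hT hz (S.B₁.flip (S.E φ)) l
    have p4 := lap_comp hT hz (S.n₁.flip φ) l
    simp only [ContinuousLinearMap.comp_apply, ContinuousLinearMap.flip_apply] at d1 d2 d3 p1 p2 p3 p4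
    simp only [cval_prodMk_zero]
    simp only [cval, Prod.map_fst, Prod.map_snd]
    rw [← p1, ← p2, ← p3, ← p4]
    rw [d1] at e
    rw [d2, d3]
    field_simp
    linear_combination (-l) * e
  · intro ψ
    have c1 : ContinuousOn (fun t => S.mz (z' t) (S.jz ψ)) (Icc 0 T) :=
      (S.mz.flip (S.jz ψ)).continuous.comp_continuousOn hz'
    have c2 : ContinuousOn (fun t => S.B₂ (S.E (u t)) ψ) (Icc 0 T) :=
      (S.B₂.flip ψ).continuous.comp_continuousOn hEu
    have c3 : ContinuousOn (fun t => S.K (y t) ψ) (Icc 0 T) :=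
      (S.K.flip ψ).continuous.comp_continuousOn hy
    have c4 : ContinuousOn (fun t => S.n₂ (v t) ψ) (Icc 0 T) :=
      (S.n₂.flip ψ).continuous.comp_continuousOn hv
    have c5 : ContinuousOn (fun t => S.S₁ (S.jz (z t)) ψ) (Icc 0 T) :=
      (S.S₁.flip ψ).continuous.comp_continuousOn hjz
    have c6 : ContinuousOn (fun t => S.S₂ (z t) (S.jz ψ)) (Icc 0 T) :=
      (S.S₂.flip (S.jz ψ)).continuous.comp_continuousOn hz
    have c7 : ContinuousOn (fun t => S.D (z t) ψ) (Icc 0 T) :=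
      (S.D.flip ψ).continuous.comp_continuousOn hz
    have e := lap_eq_zero hT (fun t ht => h.eq_z t ht ψ) l
    rw [lap_sub hT (((((c1.fun_add c2).fun_add c3).fun_add c4).fun_add c5).fun_add c6) c7,
      lap_add hT ((((c1.fun_add c2).fun_add c3).fun_add c4).fun_add c5) c6,
      lap_add hT (((c1.fun_add c2).fun_add c3).fun_add c4) c5, lap_add hT ((c1.fun_add c2).fun_add c3) c4,
      lap_add hT (c1.fun_add c2) c3, lap_add hT c1 c2] at e
    have d1 := lap_deriv_clm hT h.deriv_z h.cont_z' h.init_z (S.mz.flip (S.jz ψ)) l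
    have d2 := lap_deriv_clm hT h.deriv_u h.cont_v h.init_u ((S.B₂.flip ψ).comp S.E) l
    have d3 := lap_deriv_clm hT h.deriv_y h.cont_z h.init_y (S.K.flip ψ) l
    have p1 := lap_comp hT hz ((S.mz.flip (S.jz ψ)).comp S.jz) l
    have p2 := lap_comp hT hv ((S.B₂.flip ψ).comp S.E) l
    have p3 := lap_comp hT hz (S.K.flip ψ) l
    have p4 := lap_comp hT hv (S.n₂.flip ψ) l
    have p5 := lap_comp hT hz ((S.S₁.flip ψ).comp S.jz) l
    have p6 := lap_comp hT hz (S.S₂.flip (S.jz ψ)) l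
    have p7 := lap_comp hT hz (S.D.flip ψ) l
    simp only [ContinuousLinearMap.comp_apply, ContinuousLinearMap.flip_apply]
      at d1 d2 d3 p1 p2 p3 p4 p5 p6 p7
    simp only [cval_prodMk_zero]
    simp only [cval, Prod.map_fst, Prod.map_snd]
    rw [← p1, ← p2, ← p3, ← p4, ← p5, ← p6, ← p7]
    rw [d1] at e
    rw [d2, d3]
    field_simp
    linear_combination (-l) * e

/-- A function with controlled Laplace transform on the rays of the resolvent estimate has null
primitive. -/
theorem eq_zero_of_lap_bound {X H : Type*} [NormedAddCommGroup X] [NormedSpace ℝ X]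
    [CompleteSpace X] [NormedAddCommGroup H] [NormedSpace ℝ H] (j : X →L[ℝ] H) {x w : ℝ → X}
    (hT : 0 ≤ T) (hx : ∀ t, 0 ≤ t → HasDerivWithinAt x (w t) (Ici 0) t)
    (hw : ContinuousOn w (Ici 0)) (h0 : x 0 = 0) {σ κ r₀ : ℝ} (hσ : 0 < σ) (hκ : 0 < κ)
    (hσκ : σ ^ 2 + κ ^ 2 = 1)
    (hb : ∀ r κ' : ℝ, r₀ ≤ r → 0 < r → |κ'| = κ →
      pairNorm ((lapPair T w (r * ⟨-σ, κ'⟩)).map j j) ≤ 1) : j (x T) = 0 := by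
  -- Hahn-Banach reduces the claim to scalar entire functions.
  refine SeparatingDual.eq_zero_of_forall_dual_eq_zero (R := ℝ) fun f => ?_
  set L : X →L[ℝ] ℝ := f.comp j with hL
  have hwT : ContinuousOn w (Icc 0 T) := hw.mono Icc_subset_Ici_self
  have hg : ContinuousOn (fun t => L (w t)) (Icc 0 T) := L.continuous.comp_continuousOn hwT
  obtain ⟨C, hC, hC1, hC2⟩ := exists_norm_lap_le hT hg
  -- Far out the hypothesis on the rays applies, with bound ‖f‖; on the initial segment r < r₀ the
  -- exponential growth bound suffices.
  have hray : ∀ κ' : ℝ, |κ'| = κ → ∀ r : ℝ, 0 < r → ‖lap T (fun t => L (w t)) (r * ⟨-σ, κ'⟩)‖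
      ≤ C + ‖f‖ + C * Real.exp (T * |r₀|) := by
    intro κ' hκ' r hr
    rcases le_or_gt r₀ r with h | h
    · have h1 := hb r κ' h hr hκ'
      rw [lap_comp hT hwT]
      refine (Complex.norm_le_abs_re_add_abs_im _).trans ?_
      have h2 := f.le_opNorm (j (lapPair T w (r * ⟨-σ, κ'⟩)).1)
      have h3 := f.le_opNorm (j (lapPair T w (r * ⟨-σ, κ'⟩)).2)
      simp only [pairNorm, Prod.map_fst, Prod.map_snd] at h1
      simp only [Real.norm_eq_abs] at h2 h3
      have h4 := mul_le_mul_of_nonneg_left h1 (norm_nonneg f)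
      have h5 : 0 ≤ C * Real.exp (T * |r₀|) := by positivity
      simp only [hL, ContinuousLinearMap.comp_apply]
      linarith
    · have hw : ‖(⟨-σ, κ'⟩ : ℂ)‖ = 1 := by
        rw [Complex.norm_def, Complex.normSq_apply, Real.sqrt_eq_one]
        simp only
        rw [← hκ', sq_abs] at hσκ
        linarith
      refine (hC1 _).trans ?_
      rw [norm_mul, hw, mul_one, Complex.norm_real, Real.norm_of_nonneg hr.le]
      have : C * Real.exp (T * r) ≤ C * Real.exp (T * |r₀|) :=
        mul_le_mul_of_nonneg_left (Real.exp_le_exp.2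
          (mul_le_mul_of_nonneg_left (h.le.trans (le_abs_self _)) hT)) hC
      have := norm_nonneg f
      linarith
  have key := eq_zero_of_bounded_on_rays (differentiable_lap hT hg) hC1 hσ hκ hσκ
    (M := C + ‖f‖ + C * Real.exp (T * |r₀|))
    (fun r hr => (hC2 r (by simpa using hr.le)).trans (by
      have := norm_nonneg f
      have : 0 ≤ C * Real.exp (T * |r₀|) := by positivity
      linarith))
    (hray κ (abs_of_pos hκ)) (hray (-κ) (by rw [abs_neg, abs_of_pos hκ]))
    (tendsto_lap_atTop hT hg) 0
  -- At l = 0 the transform of w = x' is L (x T).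
  rw [lap_deriv_clm hT hx hw h0 L 0, zero_mul, sub_zero] at key
  exact_mod_cast key

/-- Solutions with null data vanish. -/
theorem IsNullSolution.eq_zero (h : S.IsNullSolution u v y z v' z') (hT : 0 ≤ T) :
    S.ju (u T) = 0 ∧ S.jz (y T) = 0 := by
  obtain ⟨σ, κ, hσ, hκ, hσκ, hS⟩ := S.exists_resolvent_bound
  -- The threshold depends on the state at `T`, which is harmless since `T` is fixed.
  obtain ⟨r₀, hr₀⟩ := hS (S.ju (v T)) (S.E (u T)) (S.jz (z T)) (y T)
  have hres : ∀ r κ' : ℝ, r₀ ≤ r → 0 < r → |κ'| = κ →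
      pairNorm ((lapPair T v (r * ⟨-σ, κ'⟩)).map S.ju S.ju) ≤ 1 ∧
      pairNorm ((lapPair T z (r * ⟨-σ, κ'⟩)).map S.jz S.jz) ≤ 1 := by
    intro r κ' hr hr0 hκ'
    refine hr₀ r κ' hr hκ' _ _ (h.isResolvent hT (mul_ne_zero ?_ ?_))
    · exact_mod_cast hr0.ne'
    · intro h0
      have := congrArg Complex.re h0
      simp only [Complex.zero_re] at this
      linarith
  exact ⟨eq_zero_of_lap_bound S.ju hT h.deriv_u h.cont_v h.init_u hσ hκ hσκ
      fun r κ' h1 h2 h3 => (hres r κ' h1 h2 h3).1,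
    eq_zero_of_lap_bound S.jz hT h.deriv_y h.cont_z h.init_y hσ hκ hσκ
      fun r κ' h1 h2 h3 => (hres r κ' h1 h2 h3).2⟩

end CoupledForms

end TypeIII

/-! ### Bounded coefficients on `L²(Ω)`. -/

namespace TypeIII

variable {Ω : TopologicalSpace.Opens E3}

/-- `f` is a pointwise representative of the element `F` of `L²(Ω)`. -/
def Rep (F : L2 Ω) (f : E3 → ℝ) : Prop :=
  (F : E3 → ℝ) =ᵐ[volume.restrict (Ω : Set E3)] f

theorem Rep.refl (F : L2 Ω) : Rep F F := Filter.EventuallyEq.rfl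

theorem Rep.add {F G : L2 Ω} {f g : E3 → ℝ} (hF : Rep F f) (hG : Rep G g) :
    Rep (F + G) (fun x => f x + g x) :=
  (Lp.coeFn_add F G).trans (Filter.EventuallyEq.add hF hG)

theorem Rep.sub {F G : L2 Ω} {f g : E3 → ℝ} (hF : Rep F f) (hG : Rep G g) :
    Rep (F - G) (fun x => f x - g x) :=
  (Lp.coeFn_sub F G).trans (Filter.EventuallyEq.sub hF hG)

theorem Rep.zero : Rep (0 : L2 Ω) (fun _ => 0) := Lp.coeFn_zero _ _ _

theorem Rep.sum {ι : Type*} (s : Finset ι) {F : ι → L2 Ω} {f : ι → E3 → ℝ}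
    (h : ∀ i, Rep (F i) (f i)) : Rep (∑ i ∈ s, F i) (fun x => ∑ i ∈ s, f i x) := by
  classical
  induction s using Finset.induction_on with
  | empty => simpa using Rep.zero
  | insert a s ha ih => simpa only [Finset.sum_insert ha] using (h a).add ih

/-- `f` is a bounded measurable coefficient on `Ω`. -/
def IsCoef (Ω : TopologicalSpace.Opens E3) (f : E3 → ℝ) : Prop :=
  MemLp f ⊤ (volume.restrict (Ω : Set E3))

open Classical in
/-- Multiplication by a bounded measurable coefficient. -/
noncomputable def mulL (Ω : TopologicalSpace.Opens E3) (f : E3 → ℝ) : L2 Ω →L[ℝ] L2 Ω :=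
  if h : IsCoef Ω f then
    (ContinuousLinearMap.mul ℝ ℝ).holderL (volume.restrict (Ω : Set E3)) ⊤ 2 2 (MemLp.toLp f h)
  else 0

theorem Rep.mulL {f p : E3 → ℝ} (hf : IsCoef Ω f) {P : L2 Ω} (hP : Rep P p) :
    Rep (mulL Ω f P) (fun x => f x * p x) := by
  rw [TypeIII.mulL, dif_pos hf]
  refine ((ContinuousLinearMap.mul ℝ ℝ).coeFn_holder (r := 2) (MemLp.toLp f hf) P).trans ?_
  filter_upwards [MemLp.coeFn_toLp hf, hP] with x h1 h2
  rw [h1, h2, ContinuousLinearMap.mul_apply']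

theorem IsCoef.congr {f g : E3 → ℝ} (hf : IsCoef Ω f) (h : EqOn f g Ω) : IsCoef Ω g :=
  (memLp_congr_ae ((ae_restrict_iff' Ω.isOpen.measurableSet).2
    (Filter.Eventually.of_forall h))).1 hf

/-- Turns the constitutive symmetries, which are pointwise relations on the closure of Ω, into
equalities of operators. Outside bounded measurable coefficients both sides are the default 0. -/
theorem mulL_congr {f g : E3 → ℝ} (h : EqOn f g Ω) : mulL Ω f = mulL Ω g := by
  by_cases hf : IsCoef Ω f
  · ext1 P
    have h1 := Rep.mulL hf (Rep.refl P)
    have h2 := Rep.mulL (hf.congr h) (Rep.refl P)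
    refine Lp.ext (h1.trans (Filter.EventuallyEq.trans ?_ h2.symm))
    refine (ae_restrict_iff' Ω.isOpen.measurableSet).2 (Filter.Eventually.of_forall fun x hx => ?_)
    simp only [h hx]
  · have hg : ¬ IsCoef Ω g := fun hg => hf (hg.congr h.symm)
    rw [mulL, mulL, dif_neg hf, dif_neg hg]

/-- The bilinear form `∫ f p q` on `L²(Ω)`. -/
noncomputable def coefForm (Ω : TopologicalSpace.Opens E3) (f : E3 → ℝ) :
    L2 Ω →L[ℝ] L2 Ω →L[ℝ] ℝ :=
  (innerSL ℝ).comp (mulL Ω f)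

theorem inner_mulL (f : E3 → ℝ) (p q : L2 Ω) : inner ℝ (mulL Ω f p) q = coefForm Ω f p q := rfl

theorem coefForm_congr {f g : E3 → ℝ} (h : EqOn f g Ω) : coefForm Ω f = coefForm Ω g := by
  rw [coefForm, coefForm, mulL_congr h]

/-- `h` is integrable on `Ω` with integral `r`. -/
def HasIntegralOn (Ω : TopologicalSpace.Opens E3) (h : E3 → ℝ) (r : ℝ) : Prop :=
  IntegrableOn h Ω ∧ ∫ x in (Ω : Set E3), h x = r

theorem HasIntegralOn.add {h k : E3 → ℝ} {r s : ℝ} (hh : HasIntegralOn Ω h r)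
    (hk : HasIntegralOn Ω k s) : HasIntegralOn Ω (fun x => h x + k x) (r + s) :=
  ⟨hh.1.add hk.1, by rw [integral_add hh.1 hk.1, hh.2, hk.2]⟩

theorem HasIntegralOn.sum {ι : Type*} (s : Finset ι) {h : ι → E3 → ℝ} {r : ι → ℝ}
    (hh : ∀ i, HasIntegralOn Ω (h i) (r i)) :
    HasIntegralOn Ω (fun x => ∑ i ∈ s, h i x) (∑ i ∈ s, r i) :=
  ⟨integrable_finsetSum s fun i _ => (hh i).1, by
    rw [integral_finsetSum s fun i _ => (hh i).1]
    exact Finset.sum_congr rfl fun i _ => (hh i).2⟩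

theorem HasIntegralOn.const_mul {h : E3 → ℝ} {r : ℝ} (hh : HasIntegralOn Ω h r) (c : ℝ) :
    HasIntegralOn Ω (fun x => c * h x) (c * r) :=
  ⟨hh.1.const_mul c, by rw [integral_const_mul, hh.2]⟩

theorem Rep.hasIntegralOn_mul {P Q : L2 Ω} {p q : E3 → ℝ} (hP : Rep P p) (hQ : Rep Q q) :
    HasIntegralOn Ω (fun x => p x * q x) (inner ℝ P Q) := by
  have hae : (fun x => inner ℝ (P x) (Q x)) =ᵐ[volume.restrict (Ω : Set E3)]
      fun x => p x * q x := by
    filter_upwards [hP, hQ] with x h1 h2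
    rw [h1, h2, real_inner_comm]
    rfl
  refine ⟨(L2.integrable_inner (𝕜 := ℝ) P Q).congr hae, ?_⟩
  rw [L2.inner_def, integral_congr_ae hae]

theorem Rep.hasIntegralOn_coef {f : E3 → ℝ} (hf : IsCoef Ω f) {P Q : L2 Ω} {p q : E3 → ℝ}
    (hP : Rep P p) (hQ : Rep Q q) :
    HasIntegralOn Ω (fun x => f x * p x * q x) (coefForm Ω f P Q) :=
  (Rep.mulL hf hP).hasIntegralOn_mul hQ

theorem coefForm_symm {f : E3 → ℝ} (p q : L2 Ω) : coefForm Ω f p q = coefForm Ω f q p := by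
  by_cases hf : IsCoef Ω f
  · rw [← (Rep.hasIntegralOn_coef hf (Rep.refl p) (Rep.refl q)).2,
      ← (Rep.hasIntegralOn_coef hf (Rep.refl q) (Rep.refl p)).2]
    congr 1 with x
    ring
  · simp [coefForm, mulL, dif_neg hf]

theorem isCoef_of_continuousOn_closure (hΩ : Bornology.IsBounded (Ω : Set E3)) {f : E3 → ℝ}
    (hf : ContinuousOn f (closure (Ω : Set E3))) : IsCoef Ω f := by
  obtain ⟨C, hC⟩ := hΩ.isCompact_closure.exists_bound_of_continuousOn hf
  refine memLp_top_of_bound ((hf.mono subset_closure).aestronglyMeasurable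
    Ω.isOpen.measurableSet) C ?_
  exact (ae_restrict_iff' Ω.isOpen.measurableSet).2
    (Filter.Eventually.of_forall fun x hx => hC x (subset_closure hx))

/-- The boundary is arbitrary, so derivatives within the closure need not be unique there. Near each
point of the closure, C¹ provides some derivative f' that is continuous at that point and agrees
with the classical one inside Ω; compactness patches the local bounds. -/
theorem exists_bound_fderiv (hΩ : Bornology.IsBounded (Ω : Set E3)) {f : E3 → ℝ}
    (hf : ContDiffOn ℝ 1 f (closure (Ω : Set E3))) :
    ∃ C, ∀ x ∈ (Ω : Set E3), ‖fderiv ℝ f x‖ ≤ C := by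
  have := hΩ.isCompact_closure.induction_on (p := fun s => ∃ C, ∀ x ∈ s ∩ Ω, ‖fderiv ℝ f x‖ ≤ C)
    ⟨0, by simp⟩
    (fun s t hst ⟨C, hC⟩ => ⟨C, fun x hx => hC x ⟨hst hx.1, hx.2⟩⟩)
    (fun s t ⟨C, hC⟩ ⟨D, hD⟩ => ⟨max C D, fun x hx => by
      rcases hx with ⟨hx | hx, hxΩ⟩
      · exact (hC x ⟨hx, hxΩ⟩).trans (le_max_left _ _)
      · exact (hD x ⟨hx, hxΩ⟩).trans (le_max_right _ _)⟩)
    (fun x hx => by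
      have h1 : ContDiffWithinAt ℝ (0 + 1) f (closure (Ω : Set E3)) x := by
        simpa using hf x hx
      obtain ⟨u, hu, -, -, f', hf', hcont⟩ :=
        (contDiffWithinAt_succ_iff_hasFDerivWithinAt' (by simp)).1 h1
      rw [insert_eq_of_mem hx] at hu
      have hbd : ∀ᶠ y in nhdsWithin x (closure (Ω : Set E3)), ‖f' y‖ ≤ ‖f' x‖ + 1 := by
        have := hcont.continuousWithinAt.norm.eventually (gt_mem_nhds (lt_add_one ‖f' x‖))
        filter_upwards [this] with y hy using hy.le
      refine ⟨_, Filter.inter_mem hu hbd, ‖f' x‖ + 1, fun y hy => ?_⟩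
      have hy1 := hf' y hy.1.1
      have hnh : closure (Ω : Set E3) ∈ nhds y :=
        Filter.mem_of_superset (Ω.isOpen.mem_nhds hy.2) subset_closure
      rw [(hy1.hasFDerivAt hnh).fderiv]
      exact hy.1.2)
  obtain ⟨C, hC⟩ := this
  exact ⟨C, fun x hx => hC x ⟨subset_closure hx, hx⟩⟩

theorem continuousOn_pderiv {f : E3 → ℝ} (hf : ContDiffOn ℝ 1 f (Ω : Set E3)) (j : Fin 3) :
    ContinuousOn (pderiv j f) Ω :=
  (hf.continuousOn_fderiv_of_isOpen Ω.isOpen le_rfl).clm_apply continuousOn_const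

theorem isCoef_pderiv (hΩ : Bornology.IsBounded (Ω : Set E3)) {f : E3 → ℝ}
    (hf : ContDiffOn ℝ 1 f (closure (Ω : Set E3))) (j : Fin 3) : IsCoef Ω (pderiv j f) := by
  obtain ⟨C, hC⟩ := exists_bound_fderiv hΩ hf
  refine memLp_top_of_bound ((continuousOn_pderiv (hf.mono subset_closure) j).aestronglyMeasurable
    Ω.isOpen.measurableSet) (C * ‖(EuclideanSpace.single j 1 : E3)‖) ?_
  refine (ae_restrict_iff' Ω.isOpen.measurableSet).2 (Filter.Eventually.of_forall fun x hx => ?_)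
  exact ((fderiv ℝ f x).le_opNorm _).trans (mul_le_mul_of_nonneg_right (hC x hx) (norm_nonneg _))

/-! ### `W₀^{1,2}(Ω)`: density of test functions and integration by parts. -/

/-- The embedding of `W₀^{1,2}(Ω)` into `L²(Ω)`. -/
noncomputable def toL2L (Ω : TopologicalSpace.Opens E3) : H01 Ω →L[ℝ] L2 Ω :=
  (ContinuousLinearMap.fst ℝ _ _).comp (H01 Ω).subtypeL

/-- The weak partial derivative on `W₀^{1,2}(Ω)`. -/
noncomputable def gradL (Ω : TopologicalSpace.Opens E3) (j : Fin 3) : H01 Ω →L[ℝ] L2 Ω :=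
  (ContinuousLinearMap.proj j).comp
    ((ContinuousLinearMap.snd ℝ _ _).comp (H01 Ω).subtypeL)

theorem memLp_of_continuous_of_hasCompactSupport (φ : E3 → ℝ) (hφ : Continuous φ) (hc : HasCompactSupport φ) :
    MemLp φ 2 (volume.restrict (Ω : Set E3)) :=
  (hφ.memLp_of_hasCompactSupport hc).restrict _

theorem continuous_pderiv_test (φ : TestFunction Ω ℝ ⊤) (j : Fin 3) :
    Continuous (pderiv j φ) :=
  (φ.contDiff.continuous_fderiv (by simp)).clm_apply continuous_const

theorem hasCompactSupport_pderiv_test (φ : TestFunction Ω ℝ ⊤) (j : Fin 3) :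
    HasCompactSupport (pderiv j φ) :=
  φ.hasCompactSupport.fderiv_apply ℝ _

theorem memLp_test (φ : TestFunction Ω ℝ ⊤) : MemLp φ 2 (volume.restrict (Ω : Set E3)) :=
  memLp_of_continuous_of_hasCompactSupport φ φ.continuous φ.hasCompactSupport

theorem memLp_pderiv_test (φ : TestFunction Ω ℝ ⊤) (j : Fin 3) :
    MemLp (pderiv j φ) 2 (volume.restrict (Ω : Set E3)) :=
  memLp_of_continuous_of_hasCompactSupport _ (continuous_pderiv_test φ j) (hasCompactSupport_pderiv_test φ j)

/-- A test function as an element of `W₀^{1,2}(Ω)`. -/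
noncomputable def testH01 (φ : TestFunction Ω ℝ ⊤) : H01 Ω :=
  ⟨(MemLp.toLp φ (memLp_test φ), fun j => MemLp.toLp (pderiv j φ) (memLp_pderiv_test φ j)),
    Submodule.le_topologicalClosure _ (Submodule.subset_span
      ⟨φ, MemLp.coeFn_toLp (memLp_test φ), fun j => MemLp.coeFn_toLp (memLp_pderiv_test φ j)⟩)⟩

theorem rep_testH01 (φ : TestFunction Ω ℝ ⊤) : Rep (toL2 (testH01 φ)) φ :=
  MemLp.coeFn_toLp (memLp_test φ)

theorem rep_grad_testH01 (φ : TestFunction Ω ℝ ⊤) (j : Fin 3) :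
    Rep (grad (testH01 φ) j) (pderiv j φ) :=
  MemLp.coeFn_toLp (memLp_pderiv_test φ j)

/-- Two continuous linear functionals that agree on test functions agree on `W₀^{1,2}(Ω)`. -/
theorem clm_eq_of_eq_on_test {L : (L2 Ω × (Fin 3 → L2 Ω)) →L[ℝ] ℝ}
    (h : ∀ φ : TestFunction Ω ℝ ⊤, L (testH01 φ).1 = 0) (w : H01 Ω) : L w.1 = 0 := by
  have hle : H01 Ω ≤ LinearMap.ker L.toLinearMap := by
    refine Submodule.topologicalClosure_minimal _ (Submodule.span_le.2 ?_) L.isClosed_ker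
    rintro p ⟨φ, h1, h2⟩
    have hp : p = (testH01 φ).1 := by
      refine Prod.ext (Lp.ext (h1.trans (rep_testH01 φ).symm)) (funext fun j => ?_)
      exact Lp.ext ((h2 j).trans (rep_grad_testH01 φ j).symm)
    rw [hp]
    exact h φ
  exact hle w.2

/-- With flux and source in L², both sides of the distributional identity are continuous in the
`W^{1,2}` norm, and test functions are dense by definition of `H01`. -/
theorem HasWeakDiv.inner_add_sum_inner_eq_zero {q : Fin 3 → E3 → ℝ} {g : E3 → ℝ}
    (h : HasWeakDiv Ω q g) {Q : Fin 3 → L2 Ω} {G : L2 Ω} (hQ : ∀ j, Rep (Q j) (q j))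
    (hG : Rep G g) (w : H01 Ω) :
    inner ℝ G (toL2 w) + ∑ j, inner ℝ (Q j) (grad w j) = 0 := by
  have := clm_eq_of_eq_on_test (Ω := Ω)
    (L := (innerSL ℝ G).comp (ContinuousLinearMap.fst ℝ _ _)
      + ∑ j, (innerSL ℝ (Q j)).comp ((ContinuousLinearMap.proj j).comp
        (ContinuousLinearMap.snd ℝ _ _))) (fun φ => ?_) w
  · simpa [_root_.sum_apply, toL2, grad] using this
  · have h1 := (hG.hasIntegralOn_mul (rep_testH01 φ)).2
    have h2 := (HasIntegralOn.sum Finset.univ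
      fun j => (hQ j).hasIntegralOn_mul (rep_grad_testH01 φ j)).2
    have h3 := h φ
    rw [h1, h2] at h3
    simp only [_root_.add_apply, _root_.sum_apply,
      ContinuousLinearMap.comp_apply, innerSL_apply_apply]
    exact eq_neg_iff_add_eq_zero.1 h3

theorem integrable_mul_of_continuousOn {k φ : E3 → ℝ} (hk : ContinuousOn k Ω)
    (hφ : Continuous φ) (hc : HasCompactSupport φ) (hs : tsupport φ ⊆ Ω) :
    Integrable (fun x => k x * φ x) := by
  have hcont : Continuous (fun x => k x * φ x) :=
    (hk.mul hφ.continuousOn).continuous_of_tsupport_subset Ω.isOpen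
      ((tsupport_mul_subset_right).trans hs)
  exact hcont.integrable_of_hasCompactSupport hc.mul_left

/-- Integration by parts for test functions and a differentiable coefficient. -/
theorem integral_coef_mul_pderiv_test {f : E3 → ℝ} (hf : ContDiffOn ℝ 1 f (Ω : Set E3))
    (θ φ : TestFunction Ω ℝ ⊤) (j : Fin 3) :
    ∫ x in (Ω : Set E3), f x * θ x * pderiv j φ x
      = - ∫ x in (Ω : Set E3), (pderiv j f x * θ x * φ x + f x * pderiv j θ x * φ x) := by
  have hfd : ∀ x ∈ (Ω : Set E3), DifferentiableAt ℝ f x := fun x hx =>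
    (hf.differentiableOn one_ne_zero x hx).differentiableAt (Ω.isOpen.mem_nhds hx)
  have hθd : ∀ x, DifferentiableAt ℝ θ x := fun x =>
    (θ.contDiff.differentiable (by simp)).differentiableAt
  have hφd : ∀ x, DifferentiableAt ℝ φ x := fun x =>
    (φ.contDiff.differentiable (by simp)).differentiableAt
  have hder : ∀ x ∈ (Ω : Set E3), fderiv ℝ (fun x => f x * θ x) x (EuclideanSpace.single j 1)
      = pderiv j f x * θ x + f x * pderiv j θ x := fun x hx => by
    rw [fderiv_fun_mul (hfd x hx) (hθd x)]
    simp only [_root_.add_apply, _root_.smul_apply, smul_eq_mul, pderiv]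
    ring
  have hc1 : ContinuousOn (fun x => pderiv j f x * θ x + f x * pderiv j θ x) Ω :=
    ((continuousOn_pderiv hf j).mul θ.continuous.continuousOn).add
      (hf.continuousOn.mul (continuous_pderiv_test θ j).continuousOn)
  have hc2 : ContinuousOn (fun x => f x * θ x) Ω := hf.continuousOn.mul θ.continuous.continuousOn
  have hcd : ContinuousOn (fun x => fderiv ℝ (fun x => f x * θ x) x (EuclideanSpace.single j 1)) Ω :=
    hc1.congr hder
  -- The coefficient is arbitrary outside Ω; differentiability of the product is needed only on the
  -- support of φ, which lies in Ω.
  have key := integral_mul_fderiv_eq_neg_fderiv_mul_of_integrable (μ := volume)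
    (f := fun x => f x * θ x) (g := φ) (v := EuclideanSpace.single j 1)
    (integrable_mul_of_continuousOn hcd φ.continuous φ.hasCompactSupport φ.tsupport_subset)
    (integrable_mul_of_continuousOn hc2 (continuous_pderiv_test φ j)
      (hasCompactSupport_pderiv_test φ j)
      ((tsupport_fderiv_apply_subset ℝ _).trans φ.tsupport_subset))
    (integrable_mul_of_continuousOn hc2 φ.continuous φ.hasCompactSupport φ.tsupport_subset)
    (fun x hx => (hfd x (φ.tsupport_subset hx)).mul (hθd x)) (fun x _ => hφd x)
  have hz : ∀ x, x ∉ (Ω : Set E3) → φ x = 0 := fun x hx =>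
    image_eq_zero_of_notMem_tsupport fun h => hx (φ.tsupport_subset h)
  have hz' : ∀ x, x ∉ (Ω : Set E3) → θ x = 0 := fun x hx =>
    image_eq_zero_of_notMem_tsupport fun h => hx (θ.tsupport_subset h)
  have e1 := setIntegral_eq_integral_of_forall_compl_eq_zero (μ := volume) (s := (Ω : Set E3))
    (f := fun x => f x * θ x * pderiv j φ x) (fun x hx => by rw [hz' x hx]; simp)
  have e2 := setIntegral_eq_integral_of_forall_compl_eq_zero (μ := volume) (s := (Ω : Set E3))
    (f := fun x => fderiv ℝ (fun x => f x * θ x) x (EuclideanSpace.single j 1) * φ x)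
    (fun x hx => by rw [hz x hx, mul_zero])
  have e3 : ∫ x in (Ω : Set E3), (pderiv j f x * θ x * φ x + f x * pderiv j θ x * φ x)
      = ∫ x in (Ω : Set E3),
        fderiv ℝ (fun x => f x * θ x) x (EuclideanSpace.single j 1) * φ x :=
    setIntegral_congr_fun Ω.isOpen.measurableSet
      (fun x hx => by simp only [hder x hx]; ring)
  rw [e1, e3, e2]
  exact key

/-- Integration by parts in `W₀^{1,2}(Ω)` with a differentiable coefficient. -/
theorem coefForm_grad {f : E3 → ℝ} (hf : ContDiffOn ℝ 1 f (Ω : Set E3)) (hf0 : IsCoef Ω f)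
    (j : Fin 3) (hf1 : IsCoef Ω (pderiv j f)) (θ w : H01 Ω) :
    coefForm Ω f (toL2 θ) (grad w j) + coefForm Ω f (grad θ j) (toL2 w)
      + coefForm Ω (pderiv j f) (toL2 θ) (toL2 w) = 0 := by
  have htest : ∀ θ φ : TestFunction Ω ℝ ⊤,
      coefForm Ω f (toL2 (testH01 θ)) (grad (testH01 φ) j)
        + coefForm Ω f (grad (testH01 θ) j) (toL2 (testH01 φ))
        + coefForm Ω (pderiv j f) (toL2 (testH01 θ)) (toL2 (testH01 φ)) = 0 := by
    intro θ φ
    have h1 := Rep.hasIntegralOn_coef hf0 (rep_testH01 θ) (rep_grad_testH01 φ j)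
    have h2 := Rep.hasIntegralOn_coef hf0 (rep_grad_testH01 θ j) (rep_testH01 φ)
    have h3 := Rep.hasIntegralOn_coef hf1 (rep_testH01 θ) (rep_testH01 φ)
    have h4 := integral_coef_mul_pderiv_test hf θ φ j
    rw [h1.2, (h3.add h2).2] at h4
    linarith
  -- The identity is extended by density one argument at a time.
  have hw : ∀ θ : TestFunction Ω ℝ ⊤, coefForm Ω f (toL2 (testH01 θ)) (grad w j)
        + coefForm Ω f (grad (testH01 θ) j) (toL2 w)
        + coefForm Ω (pderiv j f) (toL2 (testH01 θ)) (toL2 w) = 0 := fun θ =>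
    clm_eq_of_eq_on_test
      (L := (coefForm Ω f (toL2 (testH01 θ))).comp
          ((ContinuousLinearMap.proj j).comp (ContinuousLinearMap.snd ℝ _ _))
        + (coefForm Ω f (grad (testH01 θ) j)).comp (ContinuousLinearMap.fst ℝ _ _)
        + (coefForm Ω (pderiv j f) (toL2 (testH01 θ))).comp (ContinuousLinearMap.fst ℝ _ _))
      (htest θ) w
  exact clm_eq_of_eq_on_test
    (L := ((coefForm Ω f).flip (grad w j)).comp (ContinuousLinearMap.fst ℝ _ _)
      + ((coefForm Ω f).flip (toL2 w)).comp
          ((ContinuousLinearMap.proj j).comp (ContinuousLinearMap.snd ℝ _ _))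
      + ((coefForm Ω (pderiv j f)).flip (toL2 w)).comp (ContinuousLinearMap.fst ℝ _ _)) hw θ

theorem norm_toL2_le (w : H01 Ω) : ‖toL2 w‖ ≤ ‖w‖ := norm_fst_le w.1

theorem norm_grad_le (w : H01 Ω) (j : Fin 3) : ‖grad w j‖ ≤ ‖w‖ :=
  (norm_le_pi_norm w.1.2 j).trans (norm_snd_le w.1)

/-- A derivative can be moved to the other factor. -/
theorem exists_abs_coefForm_grad_le (hΩ : Bornology.IsBounded (Ω : Set E3)) {f : E3 → ℝ}
    (hf : ContDiffOn ℝ 1 f (closure (Ω : Set E3))) (j : Fin 3) :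
    ∃ C, 0 ≤ C ∧ ∀ θ w : H01 Ω, |coefForm Ω f (toL2 θ) (grad w j)| ≤ C * ‖θ‖ * ‖toL2 w‖ := by
  refine ⟨‖coefForm Ω f‖ + ‖coefForm Ω (pderiv j f)‖, by positivity, fun θ w => ?_⟩
  have h := coefForm_grad (hf.mono subset_closure) (isCoef_of_continuousOn_closure hΩ
    hf.continuousOn) j (isCoef_pderiv hΩ hf j) θ w
  have h1 := (coefForm Ω f).le_opNorm₂ (grad θ j) (toL2 w)
  have h2 := (coefForm Ω (pderiv j f)).le_opNorm₂ (toL2 θ) (toL2 w)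
  have h3 : ‖coefForm Ω f‖ * ‖grad θ j‖ * ‖toL2 w‖ ≤ ‖coefForm Ω f‖ * ‖θ‖ * ‖toL2 w‖ := by
    gcongr
    exact norm_grad_le θ j
  have h4 : ‖coefForm Ω (pderiv j f)‖ * ‖toL2 θ‖ * ‖toL2 w‖
      ≤ ‖coefForm Ω (pderiv j f)‖ * ‖θ‖ * ‖toL2 w‖ := by
    gcongr
    exact norm_toL2_le θ
  rw [Real.norm_eq_abs] at h1 h2
  have h5 : coefForm Ω f (toL2 θ) (grad w j) = -(coefForm Ω f (grad θ j) (toL2 w)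
    + coefForm Ω (pderiv j f) (toL2 θ) (toL2 w)) := by linarith
  rw [h5, abs_neg]
  refine (abs_add_le _ _).trans ?_
  linarith

/-- Elements of `H01` carry their gradient, so it must be seen to be determined by the function:
integration by parts with coefficient 1 makes it orthogonal to all test functions. The abstract
theorem yields vanishing only in the pivot spaces. -/
theorem toL2_injective {w : H01 Ω} (hw : toL2 w = 0) : w = 0 := by
  have h1 : ∀ j, grad w j = 0 := by
    intro j
    have hcoef : IsCoef Ω (fun _ => (1 : ℝ)) := memLp_top_const 1
    have hp : pderiv j (fun _ : E3 => (1 : ℝ)) = fun _ => 0 := by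
      funext x
      simp [pderiv]
    have hcoef' : IsCoef Ω (pderiv j (fun _ : E3 => (1 : ℝ))) := by
      rw [hp]
      exact memLp_top_const 0
    have hzero : ∀ φ : TestFunction Ω ℝ ⊤,
        ∫ x in (Ω : Set E3), φ x * grad w j x = 0 := by
      intro φ
      have h := coefForm_grad (f := fun _ => (1 : ℝ)) contDiffOn_const hcoef j hcoef' w (testH01 φ)
      rw [hw, map_zero, map_zero, _root_.zero_apply, _root_.zero_apply,
        zero_add, add_zero, ← (Rep.hasIntegralOn_coef hcoef (Rep.refl _) (rep_testH01 φ)).2] at h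
      simpa [mul_comm] using h
    have hloc : LocallyIntegrableOn (grad w j : E3 → ℝ) Ω (volume.restrict (Ω : Set E3)) :=
      ((Lp.memLp (grad w j)).locallyIntegrable (by norm_num)).locallyIntegrableOn _
    have := Ω.isOpen.ae_eq_zero_of_integral_contDiff_smul_eq_zero hloc
      (fun g hg1 hg2 hg3 => hzero ⟨g, hg1, hg2, hg3⟩)
    refine Lp.ext (Filter.EventuallyEq.trans ?_ (Lp.coeFn_zero _ _ _).symm)
    filter_upwards [this, ae_restrict_mem Ω.isOpen.measurableSet] with x hx hxΩ
    exact hx hxΩ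
  exact Subtype.ext (Prod.ext hw (funext h1))

end TypeIII

/-! ### The bilinear forms of the type III system. -/

namespace TypeIII

section Components

variable (Ω : TopologicalSpace.Opens E3)

/-- The embedding of `W₀^{1,2}(Ω)³` into `L²(Ω)³`. -/
noncomputable def vecToL2L : (Fin 3 → H01 Ω) →L[ℝ] (Fin 3 → L2 Ω) :=
  ContinuousLinearMap.pi fun i => (toL2L Ω).comp (ContinuousLinearMap.proj i)

/-- The embedding of the space of pairs of a scalar and a vector. -/
noncomputable def pairToL2L : (H01 Ω × (Fin 3 → H01 Ω)) →L[ℝ] (L2 Ω × (Fin 3 → L2 Ω)) :=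
  (toL2L Ω).prodMap (vecToL2L Ω)

/-- The strain as an element of `L²(Ω)`. -/
noncomputable def strainL : (Fin 3 → H01 Ω) →L[ℝ] (Fin 3 → Fin 3 → L2 Ω) :=
  ContinuousLinearMap.pi fun i => ContinuousLinearMap.pi fun k =>
    (1 / 2 : ℝ) • ((gradL Ω k).comp (ContinuousLinearMap.proj i)
      + (gradL Ω i).comp (ContinuousLinearMap.proj k))

/-- A component of a second order tensor field. -/
noncomputable def tensorProj (i k : Fin 3) : (Fin 3 → Fin 3 → L2 Ω) →L[ℝ] L2 Ω :=
  (ContinuousLinearMap.proj (R := ℝ) (φ := fun _ : Fin 3 => L2 Ω) k).comp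
    (ContinuousLinearMap.proj (R := ℝ) (φ := fun _ : Fin 3 => Fin 3 → L2 Ω) i)

/-- A partial derivative of the scalar in a pair. -/
noncomputable def gradFst (j : Fin 3) : (H01 Ω × (Fin 3 → H01 Ω)) →L[ℝ] L2 Ω :=
  (gradL Ω j).comp (ContinuousLinearMap.fst ℝ _ _)

/-- A partial derivative of a component of the vector in a pair. -/
noncomputable def gradSnd (i j : Fin 3) : (H01 Ω × (Fin 3 → H01 Ω)) →L[ℝ] L2 Ω :=
  (gradL Ω j).comp ((ContinuousLinearMap.proj i).comp (ContinuousLinearMap.snd ℝ _ _))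

/-- A component of the vector in a pair. -/
noncomputable def sndProj (i : Fin 3) : (L2 Ω × (Fin 3 → L2 Ω)) →L[ℝ] L2 Ω :=
  (ContinuousLinearMap.proj i).comp (ContinuousLinearMap.snd ℝ _ _)

/-- The form `∫ f (P x) (Q y)`. -/
noncomputable def formOf {X Y : Type*} [NormedAddCommGroup X] [NormedSpace ℝ X]
    [NormedAddCommGroup Y] [NormedSpace ℝ Y] (f : E3 → ℝ) (P : X →L[ℝ] L2 Ω) (Q : Y →L[ℝ] L2 Ω) :
    X →L[ℝ] Y →L[ℝ] ℝ :=
  (coefForm Ω f).bilinearComp P Q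

end Components

variable {Ω : TopologicalSpace.Opens E3}

theorem formOf_apply {X Y : Type*} [NormedAddCommGroup X] [NormedSpace ℝ X]
    [NormedAddCommGroup Y] [NormedSpace ℝ Y] (f : E3 → ℝ) (P : X →L[ℝ] L2 Ω) (Q : Y →L[ℝ] L2 Ω)
    (x : X) (y : Y) : formOf Ω f P Q x y = coefForm Ω f (P x) (Q y) := rfl

theorem strainL_apply (u : Fin 3 → H01 Ω) (i k : Fin 3) :
    strainL Ω u i k = (1 / 2 : ℝ) • (grad (u i) k + grad (u k) i) := rfl

theorem rep_strainL (u : Fin 3 → H01 Ω) (i k : Fin 3) : Rep (strainL Ω u i k) (strain u i k) := by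
  rw [strainL_apply]
  refine (Lp.coeFn_smul _ _).trans ?_
  filter_upwards [Lp.coeFn_add (grad (u i) k) (grad (u k) i)] with x hx
  rw [Pi.smul_apply, hx, Pi.add_apply, strain, smul_eq_mul]
  ring

section Forms

/-- Shortcut for the additive structure on bilinear forms. -/
noncomputable instance bilinFormAddCommMonoid {X Y : Type*} [NormedAddCommGroup X]
    [NormedSpace ℝ X] [NormedAddCommGroup Y] [NormedSpace ℝ Y] :
    AddCommMonoid (X →L[ℝ] Y →L[ℝ] ℝ) := inferInstance

variable (Ω) (m : Material)

/-- The inertia of the displacement. -/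
noncomputable def massU : (Fin 3 → L2 Ω) →L[ℝ] (Fin 3 → L2 Ω) →L[ℝ] ℝ :=
  ∑ i, formOf Ω m.rho (ContinuousLinearMap.proj i) (ContinuousLinearMap.proj i)

/-- The inertia of the thermal variables. -/
noncomputable def massZ : (L2 Ω × (Fin 3 → L2 Ω)) →L[ℝ] (L2 Ω × (Fin 3 → L2 Ω)) →L[ℝ] ℝ :=
  formOf Ω m.c (ContinuousLinearMap.fst ℝ _ _) (ContinuousLinearMap.fst ℝ _ _)
    + ∑ i, ∑ j, formOf Ω (m.cm i j) (sndProj Ω j) (sndProj Ω i)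

/-- The elastic stiffness. -/
noncomputable def stiffU :
    (Fin 3 → Fin 3 → L2 Ω) →L[ℝ] (Fin 3 → Fin 3 → L2 Ω) →L[ℝ] ℝ :=
  ∑ i, ∑ j, ∑ k, ∑ l, formOf Ω (m.A j i k l) (tensorProj Ω k l) (tensorProj Ω i j)

/-- The form of `B` in the momentum equation. -/
noncomputable def coupleU :
    (H01 Ω × (Fin 3 → H01 Ω)) →L[ℝ] (Fin 3 → Fin 3 → L2 Ω) →L[ℝ] ℝ :=
  ∑ i, ∑ j, ∑ k, ∑ l, formOf Ω (m.B j i k l) (gradSnd Ω l k) (tensorProj Ω i j)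

/-- The form of `B` in the equation for the moments. -/
noncomputable def coupleZ :
    (Fin 3 → Fin 3 → L2 Ω) →L[ℝ] (H01 Ω × (Fin 3 → H01 Ω)) →L[ℝ] ℝ :=
  ∑ i, ∑ j, ∑ k, ∑ l, formOf Ω (m.B k l j i) (tensorProj Ω k l) (gradSnd Ω i j)

/-- The thermal stiffness. -/
noncomputable def stiffZ :
    (H01 Ω × (Fin 3 → H01 Ω)) →L[ℝ] (H01 Ω × (Fin 3 → H01 Ω)) →L[ℝ] ℝ :=
  ∑ i, ∑ j, formOf Ω (m.K i j) (gradFst Ω j) (gradFst Ω i)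
    + ∑ i, ∑ j, ∑ k, ∑ l, formOf Ω (m.C j i k l) (gradSnd Ω k l) (gradSnd Ω i j)

/-- The damping. -/
noncomputable def dampZ :
    (H01 Ω × (Fin 3 → H01 Ω)) →L[ℝ] (H01 Ω × (Fin 3 → H01 Ω)) →L[ℝ] ℝ :=
  ∑ i, ∑ j, formOf Ω (m.Kt i j) (gradFst Ω j) (gradFst Ω i)
    + ∑ i, ∑ j, ∑ k, ∑ l, formOf Ω (m.Ct j i k l) (gradSnd Ω k l) (gradSnd Ω i j)

/-- The thermal stress. -/
noncomputable def thermalU : (H01 Ω × (Fin 3 → H01 Ω)) →L[ℝ] (Fin 3 → H01 Ω) →L[ℝ] ℝ :=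
  ∑ i, ∑ j, formOf Ω (m.a j i) ((toL2L Ω).comp (ContinuousLinearMap.fst ℝ _ _))
    ((gradL Ω j).comp (ContinuousLinearMap.proj i))

/-- The heating due to the strain rate. -/
noncomputable def thermalZ : (Fin 3 → H01 Ω) →L[ℝ] (H01 Ω × (Fin 3 → H01 Ω)) →L[ℝ] ℝ :=
  -∑ i, ∑ j, formOf Ω (m.a i j) ((tensorProj Ω i j).comp (strainL Ω))
    ((toL2L Ω).comp (ContinuousLinearMap.fst ℝ _ _))

/-- Lower order terms tested with gradients. -/
noncomputable def lowerH : (L2 Ω × (Fin 3 → L2 Ω)) →L[ℝ] (H01 Ω × (Fin 3 → H01 Ω)) →L[ℝ] ℝ :=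
  ∑ i, ∑ j, formOf Ω (m.d i j) (sndProj Ω j) (gradFst Ω i)
    + ∑ i, ∑ j, formOf Ω (m.b j i) (ContinuousLinearMap.fst ℝ _ _) (gradSnd Ω i j)

/-- Lower order terms involving gradients. -/
noncomputable def lowerV : (H01 Ω × (Fin 3 → H01 Ω)) →L[ℝ] (L2 Ω × (Fin 3 → L2 Ω)) →L[ℝ] ℝ :=
  -(∑ i, ∑ j, formOf Ω (m.b i j) (gradSnd Ω i j) (ContinuousLinearMap.fst ℝ _ _)
    + ∑ i, ∑ j, formOf Ω (m.d i j) (gradFst Ω j) (sndProj Ω i))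

variable {Ω}

theorem massU_apply (p q : Fin 3 → L2 Ω) :
    massU Ω m p q = ∑ i, coefForm Ω m.rho (p i) (q i) := by
  simp only [massU, _root_.sum_apply, formOf_apply, ContinuousLinearMap.proj_apply]

theorem massZ_apply (p q : L2 Ω × (Fin 3 → L2 Ω)) :
    massZ Ω m p q = coefForm Ω m.c p.1 q.1 + ∑ i, ∑ j, coefForm Ω (m.cm i j) (p.2 j) (q.2 i) := by
  simp only [massZ, _root_.sum_apply, _root_.add_apply, formOf_apply]
  rfl

theorem stiffU_apply (p q : Fin 3 → Fin 3 → L2 Ω) : stiffU Ω m p q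
    = ∑ i, ∑ j, ∑ k, ∑ l, coefForm Ω (m.A j i k l) (p k l) (q i j) := by
  simp only [stiffU, _root_.sum_apply, formOf_apply]
  rfl

theorem coupleU_apply (y : H01 Ω × (Fin 3 → H01 Ω)) (q : Fin 3 → Fin 3 → L2 Ω) : coupleU Ω m y q
    = ∑ i, ∑ j, ∑ k, ∑ l, coefForm Ω (m.B j i k l) (grad (y.2 l) k) (q i j) := by
  simp only [coupleU, _root_.sum_apply, formOf_apply]
  rfl

theorem coupleZ_apply (p : Fin 3 → Fin 3 → L2 Ω) (z : H01 Ω × (Fin 3 → H01 Ω)) : coupleZ Ω m p z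
    = ∑ i, ∑ j, ∑ k, ∑ l, coefForm Ω (m.B k l j i) (p k l) (grad (z.2 i) j) := by
  simp only [coupleZ, _root_.sum_apply, formOf_apply]
  rfl

theorem stiffZ_apply (y z : H01 Ω × (Fin 3 → H01 Ω)) : stiffZ Ω m y z
    = ∑ i, ∑ j, coefForm Ω (m.K i j) (grad y.1 j) (grad z.1 i)
      + ∑ i, ∑ j, ∑ k, ∑ l, coefForm Ω (m.C j i k l) (grad (y.2 k) l) (grad (z.2 i) j) := by
  simp only [stiffZ, _root_.sum_apply, _root_.add_apply, formOf_apply]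
  rfl

theorem dampZ_apply (y z : H01 Ω × (Fin 3 → H01 Ω)) : dampZ Ω m y z
    = ∑ i, ∑ j, coefForm Ω (m.Kt i j) (grad y.1 j) (grad z.1 i)
      + ∑ i, ∑ j, ∑ k, ∑ l, coefForm Ω (m.Ct j i k l) (grad (y.2 k) l) (grad (z.2 i) j) := by
  simp only [dampZ, _root_.sum_apply, _root_.add_apply, formOf_apply]
  rfl

theorem thermalU_apply (z : H01 Ω × (Fin 3 → H01 Ω)) (φ : Fin 3 → H01 Ω) : thermalU Ω m z φ
    = ∑ i, ∑ j, coefForm Ω (m.a j i) (toL2 z.1) (grad (φ i) j) := by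
  simp only [thermalU, _root_.sum_apply, formOf_apply]
  rfl

theorem thermalZ_apply (v : Fin 3 → H01 Ω) (ψ : H01 Ω × (Fin 3 → H01 Ω)) : thermalZ Ω m v ψ
    = -∑ i, ∑ j, coefForm Ω (m.a i j) (strainL Ω v i j) (toL2 ψ.1) := by
  simp only [thermalZ]
  rfl

theorem lowerH_apply (p : L2 Ω × (Fin 3 → L2 Ω)) (ψ : H01 Ω × (Fin 3 → H01 Ω)) : lowerH Ω m p ψ
    = ∑ i, ∑ j, coefForm Ω (m.d i j) (p.2 j) (grad ψ.1 i)
      + ∑ i, ∑ j, coefForm Ω (m.b j i) p.1 (grad (ψ.2 i) j) := by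
  simp only [lowerH, _root_.sum_apply, _root_.add_apply, formOf_apply]
  rfl

theorem lowerV_apply (z : H01 Ω × (Fin 3 → H01 Ω)) (q : L2 Ω × (Fin 3 → L2 Ω)) : lowerV Ω m z q
    = -(∑ i, ∑ j, coefForm Ω (m.b i j) (grad (z.2 i) j) q.1
      + ∑ i, ∑ j, coefForm Ω (m.d i j) (grad z.1 j) (q.2 i)) := by
  simp only [lowerV, _root_.sum_apply, _root_.add_apply, _root_.neg_apply, formOf_apply]
  rfl

end Forms

/-! ### Symmetry and coercivity of inertia and stiffness. -/

section Positivity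

theorem sq_norm_pi_le_sum {X : Type*} [SeminormedAddCommGroup X] (x : Fin 3 → X) :
    ‖x‖ ^ 2 ≤ ∑ i, ‖x i‖ ^ 2 := by
  have h : 0 ≤ ∑ i, ‖x i‖ ^ 2 := Finset.sum_nonneg fun i _ => sq_nonneg _
  refine (Real.le_sqrt (norm_nonneg _) h).1 ((pi_norm_le_iff_of_nonneg (Real.sqrt_nonneg _)).2
    fun i => ?_)
  exact (Real.le_sqrt (norm_nonneg _) h).2
    (Finset.single_le_sum (f := fun i => ‖x i‖ ^ 2) (fun i _ => sq_nonneg _) (Finset.mem_univ i))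

theorem HasIntegralOn.mono {h k : E3 → ℝ} {r s : ℝ} (hh : HasIntegralOn Ω h r)
    (hk : HasIntegralOn Ω k s) (hle : ∀ x ∈ (Ω : Set E3), h x ≤ k x) : r ≤ s := by
  rw [← hh.2, ← hk.2]
  exact setIntegral_mono_on hh.1 hk.1 Ω.isOpen.measurableSet hle

theorem mul_sq_norm_le_coefForm {f : E3 → ℝ} (hf : IsCoef Ω f) {c : ℝ}
    (hc : ∀ x ∈ (Ω : Set E3), c ≤ f x) (p : L2 Ω) : c * ‖p‖ ^ 2 ≤ coefForm Ω f p p := by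
  rw [← real_inner_self_eq_norm_sq]
  refine (((Rep.refl p).hasIntegralOn_mul (Rep.refl p)).const_mul c).mono
    (Rep.hasIntegralOn_coef hf (Rep.refl p) (Rep.refl p)) fun x hx => ?_
  rw [mul_assoc]
  exact mul_le_mul_of_nonneg_right (hc x hx) (mul_self_nonneg _)

variable {m : Material}

theorem isCoef_of_contDiffOn_closure (hΩ : Bornology.IsBounded (Ω : Set E3)) {f : E3 → ℝ}
    (hf : ContDiffOn ℝ 1 f (closure (Ω : Set E3))) : IsCoef Ω f :=
  isCoef_of_continuousOn_closure hΩ hf.continuousOn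

theorem massU_pos (hΩ : Bornology.IsBounded (Ω : Set E3)) (hC1 : m.IsC1 Ω)
    (hin : m.InertiaPos Ω) : ∃ c > 0, ∀ p : Fin 3 → L2 Ω, c * ‖p‖ ^ 2 ≤ massU Ω m p p := by
  obtain ⟨c, hc, hle⟩ := hΩ.isCompact_closure.exists_forall_le' hC1.rho.continuousOn hin.rho
  refine ⟨c, hc, fun p => ?_⟩
  rw [massU_apply]
  refine (mul_le_mul_of_nonneg_left (sq_norm_pi_le_sum p) hc.le).trans ?_
  rw [Finset.mul_sum]
  exact Finset.sum_le_sum fun i _ => mul_sq_norm_le_coefForm (isCoef_of_contDiffOn_closure hΩ hC1.rho)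
    (fun x hx => hle x (subset_closure hx)) (p i)

/-- Pointwise positive definiteness becomes uniform by compactness of the closure of Ω times the
unit sphere, then by homogeneity. -/
theorem exists_cm_lower_bound (hΩ : Bornology.IsBounded (Ω : Set E3)) (hC1 : m.IsC1 Ω)
    (hin : m.InertiaPos Ω) : ∃ c > 0, ∀ x ∈ closure (Ω : Set E3), ∀ ξ : Fin 3 → ℝ,
      c * ∑ i, ξ i * ξ i ≤ ∑ i, ∑ j, m.cm i j x * ξ i * ξ j := by
  have hcont : ContinuousOn (fun q : E3 × (Fin 3 → ℝ) => ∑ i, ∑ j, m.cm i j q.1 * q.2 i * q.2 j)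
      (closure (Ω : Set E3) ×ˢ Metric.sphere (0 : Fin 3 → ℝ) 1) := by
    refine continuousOn_finsetSum _ fun i _ => continuousOn_finsetSum _ fun j _ => ?_
    refine ((((hC1.cm i j).continuousOn.comp continuousOn_fst fun q hq => hq.1)).mul ?_).mul ?_
    · exact ((continuous_apply i).comp continuous_snd).continuousOn
    · exact ((continuous_apply j).comp continuous_snd).continuousOn
  obtain ⟨c, hc, hle⟩ := (hΩ.isCompact_closure.prod (isCompact_sphere 0 1)).exists_forall_le' hcont
    (a := 0) (fun q hq => hin.cm q.1 hq.1 q.2 fun h0 => by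
      have := hq.2
      rw [h0, mem_sphere_zero_iff_norm, norm_zero] at this
      exact zero_ne_one this)
  -- The sphere is that of the maximum norm, and ∑ ξᵢ² ≤ 3‖ξ‖² in that norm.
  refine ⟨c / 3, by positivity, fun x hx ξ => ?_⟩
  rcases eq_or_ne ξ 0 with rfl | hξ
  · simp
  have hn : 0 < ‖ξ‖ := norm_pos_iff.2 hξ
  have h1 := hle (x, ‖ξ‖⁻¹ • ξ) ⟨hx, by
    rw [mem_sphere_zero_iff_norm, norm_smul, norm_inv, norm_norm, inv_mul_cancel₀ hn.ne']⟩
  have h2 : ∑ i, ∑ j, m.cm i j x * (‖ξ‖⁻¹ • ξ) i * (‖ξ‖⁻¹ • ξ) j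
      = (∑ i, ∑ j, m.cm i j x * ξ i * ξ j) / ‖ξ‖ ^ 2 := by
    simp only [Finset.sum_div, Pi.smul_apply, smul_eq_mul]
    refine Finset.sum_congr rfl fun i _ => Finset.sum_congr rfl fun j _ => ?_
    field_simp
  rw [h2, le_div_iff₀ (by positivity)] at h1
  have h3 : ∑ i, ξ i * ξ i ≤ 3 * ‖ξ‖ ^ 2 := by
    have : ∀ i, ξ i * ξ i ≤ ‖ξ‖ ^ 2 := fun i => by
      rw [← sq, ← sq_abs]
      exact pow_le_pow_left₀ (abs_nonneg _) (norm_le_pi_norm ξ i) 2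
    refine (Finset.sum_le_sum fun i _ => this i).trans ?_
    simp
  have h4 := mul_le_mul_of_nonneg_left h3 (by positivity : 0 ≤ c / 3)
  linarith

theorem massZ_pos (hΩ : Bornology.IsBounded (Ω : Set E3)) (hC1 : m.IsC1 Ω)
    (hin : m.InertiaPos Ω) :
    ∃ c > 0, ∀ p : L2 Ω × (Fin 3 → L2 Ω), c * ‖p‖ ^ 2 ≤ massZ Ω m p p := by
  obtain ⟨c, hc, hle⟩ := hΩ.isCompact_closure.exists_forall_le' hC1.c.continuousOn hin.c
  obtain ⟨c', hc', hle'⟩ := exists_cm_lower_bound hΩ hC1 hin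
  refine ⟨min c c', lt_min hc hc', fun p => ?_⟩
  rw [massZ_apply]
  have h1 := mul_sq_norm_le_coefForm (isCoef_of_contDiffOn_closure hΩ hC1.c)
    (fun x hx => hle x (subset_closure hx)) p.1
  have h2 : c' * ∑ i, ‖p.2 i‖ ^ 2 ≤ ∑ i, ∑ j, coefForm Ω (m.cm i j) (p.2 j) (p.2 i) := by
    simp only [← real_inner_self_eq_norm_sq]
    refine ((HasIntegralOn.sum Finset.univ fun i =>
      (Rep.refl (p.2 i)).hasIntegralOn_mul (Rep.refl (p.2 i))).const_mul c').mono
      (HasIntegralOn.sum Finset.univ fun i => HasIntegralOn.sum Finset.univ fun j =>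
        Rep.hasIntegralOn_coef (isCoef_of_contDiffOn_closure hΩ (hC1.cm i j)) (Rep.refl (p.2 j))
          (Rep.refl (p.2 i))) fun x hx => ?_
    refine (hle' x (subset_closure hx) fun i => p.2 i x).trans (le_of_eq ?_)
    refine Finset.sum_congr rfl fun i _ => Finset.sum_congr rfl fun j _ => ?_
    ring
  have h3 : ‖p‖ ^ 2 ≤ ‖p.1‖ ^ 2 + ‖p.2‖ ^ 2 := by
    rw [Prod.norm_def]
    rcases max_cases ‖p.1‖ ‖p.2‖ with h | h <;> rw [h.1] <;> nlinarith [sq_nonneg ‖p.1‖, sq_nonneg ‖p.2‖]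
  have h4 := sq_norm_pi_le_sum p.2
  have h5 : 0 ≤ min c c' := (lt_min hc hc').le
  calc min c c' * ‖p‖ ^ 2 ≤ min c c' * (‖p.1‖ ^ 2 + ∑ i, ‖p.2 i‖ ^ 2) :=
        mul_le_mul_of_nonneg_left (by linarith) h5
    _ = min c c' * ‖p.1‖ ^ 2 + min c c' * ∑ i, ‖p.2 i‖ ^ 2 := by ring
    _ ≤ c * ‖p.1‖ ^ 2 + c' * ∑ i, ‖p.2 i‖ ^ 2 :=
        add_le_add (mul_le_mul_of_nonneg_right (min_le_left _ _) (sq_nonneg _))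
          (mul_le_mul_of_nonneg_right (min_le_right _ _)
            (Finset.sum_nonneg fun i _ => sq_nonneg _))
    _ ≤ _ := add_le_add h1 h2

theorem massU_symm (p q : Fin 3 → L2 Ω) : massU Ω m p q = massU Ω m q p := by
  simp only [massU_apply]
  exact Finset.sum_congr rfl fun i _ => coefForm_symm _ _

theorem massZ_symm (hs : m.IsSymm Ω) (p q : L2 Ω × (Fin 3 → L2 Ω)) :
    massZ Ω m p q = massZ Ω m q p := by
  simp only [massZ_apply]
  rw [coefForm_symm p.1, Finset.sum_comm]
  refine congrArg _ (Finset.sum_congr rfl fun i _ => Finset.sum_congr rfl fun j _ => ?_)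
  rw [coefForm_symm, coefForm_congr fun x hx => hs.cm x (subset_closure hx) j i]

theorem sum_swap_pairs (f : Fin 3 → Fin 3 → Fin 3 → Fin 3 → ℝ) :
    ∑ i, ∑ j, ∑ k, ∑ l, f i j k l = ∑ i, ∑ j, ∑ k, ∑ l, f k l i j := by
  have h1 : ∀ g : Fin 3 → Fin 3 → ℝ, ∑ i, ∑ j, g i j = ∑ q : Fin 3 × Fin 3, g q.1 q.2 :=
    fun g => (Fintype.sum_prod_type' g).symm
  simp only [h1]
  rw [Finset.sum_comm]

/-- Exchanging the index pairs requires A_{lkij} = A_{jikl}: a minor, the major and again a minor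
symmetry. -/
theorem stiffU_symm (hs : m.IsSymm Ω) (p q : Fin 3 → Fin 3 → L2 Ω) :
    stiffU Ω m p q = stiffU Ω m q p := by
  rw [stiffU_apply, stiffU_apply, sum_swap_pairs]
  refine Finset.sum_congr rfl fun i _ => Finset.sum_congr rfl fun j _ =>
    Finset.sum_congr rfl fun k _ => Finset.sum_congr rfl fun l _ => ?_
  rw [coefForm_symm, coefForm_congr fun x hx => ?_]
  have hx' := subset_closure hx
  rw [hs.A_minor x hx' l k i j, hs.A_major x hx' k l i j, hs.A_minor x hx' i j k l]

theorem stiffU_pos (hΩ : Bornology.IsBounded (Ω : Set E3)) (hC1 : m.IsC1 Ω) (hs : m.IsSymm Ω)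
    (hst : m.StoredEnergyPos Ω) :
    ∃ c > 0, ∀ v : Fin 3 → H01 Ω, c * ‖strainL Ω v‖ ^ 2 ≤ stiffU Ω m (strainL Ω v) (strainL Ω v) := by
  obtain ⟨c, hc, h⟩ := hst
  refine ⟨c, hc, fun v => ?_⟩
  -- With τ = R = 0 only the elastic part of the stored energy remains.
  have h1 := h v 0 0
  have e := rep_strainL v
  have z : ∀ j, Rep (grad (0 : H01 Ω) j) (grad (0 : H01 Ω) j) := fun j => Rep.refl _
  have i1 := ((HasIntegralOn.sum Finset.univ fun i => HasIntegralOn.sum Finset.univ fun j =>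
      (e i j).hasIntegralOn_mul (e i j)).add
    (HasIntegralOn.sum Finset.univ fun i => (z i).hasIntegralOn_mul (z i))).add
    (HasIntegralOn.sum Finset.univ fun _ : Fin 3 => HasIntegralOn.sum Finset.univ fun j =>
      (z j).hasIntegralOn_mul (z j))
  have i2 := (((HasIntegralOn.sum Finset.univ fun i => HasIntegralOn.sum Finset.univ fun j =>
      HasIntegralOn.sum Finset.univ fun k => HasIntegralOn.sum Finset.univ fun l =>
      Rep.hasIntegralOn_coef (isCoef_of_contDiffOn_closure hΩ (hC1.A i j k l)) (e k l) (e i j)).add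
    ((HasIntegralOn.sum Finset.univ fun i => HasIntegralOn.sum Finset.univ fun j =>
      HasIntegralOn.sum Finset.univ fun k => HasIntegralOn.sum Finset.univ fun l =>
      Rep.hasIntegralOn_coef (isCoef_of_contDiffOn_closure hΩ (hC1.B i j k l)) (e i j) (z l)).const_mul 2)).add
    (HasIntegralOn.sum Finset.univ fun i => HasIntegralOn.sum Finset.univ fun j =>
      Rep.hasIntegralOn_coef (isCoef_of_contDiffOn_closure hΩ (hC1.K i j)) (z i) (z j))).add
    (HasIntegralOn.sum Finset.univ fun i => HasIntegralOn.sum Finset.univ fun j =>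
      HasIntegralOn.sum Finset.univ fun k => HasIntegralOn.sum Finset.univ fun l =>
      Rep.hasIntegralOn_coef (isCoef_of_contDiffOn_closure hΩ (hC1.C i j k l)) (z j) (z l))
  have g0 : ∀ j, grad (0 : H01 Ω) j = 0 := fun j => rfl
  simp only [Pi.zero_apply] at h1
  rw [i1.2, i2.2] at h1
  simp only [g0, map_zero, inner_zero_left, Finset.sum_const_zero, mul_zero, add_zero,
    real_inner_self_eq_norm_sq] at h1
  rw [stiffU_apply]
  have hA : ∑ i, ∑ j, ∑ k, ∑ l, coefForm Ω (m.A i j k l) (strainL Ω v k l) (strainL Ω v i j)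
      = ∑ i, ∑ j, ∑ k, ∑ l, coefForm Ω (m.A j i k l) (strainL Ω v k l) (strainL Ω v i j) := by
    refine Finset.sum_congr rfl fun i _ => Finset.sum_congr rfl fun j _ =>
      Finset.sum_congr rfl fun k _ => Finset.sum_congr rfl fun l _ => ?_
    rw [coefForm_congr fun x hx => hs.A_minor x (subset_closure hx) i j k l]
  rw [hA] at h1
  refine le_trans ?_ h1
  refine mul_le_mul_of_nonneg_left ?_ hc.le
  exact (sq_norm_pi_le_sum _).trans (Finset.sum_le_sum fun i _ => sq_norm_pi_le_sum _)

end Positivity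

end TypeIII

/-! ### Damping, velocity couplings and the assembled forms. -/

namespace TypeIII

variable {Ω : TopologicalSpace.Opens E3} {m : Material}

theorem sum_rotate (f : Fin 3 → Fin 3 → Fin 3 → Fin 3 → ℝ) :
    ∑ i, ∑ j, ∑ k, ∑ l, f i j k l = ∑ i, ∑ j, ∑ k, ∑ l, f l k i j := by
  calc ∑ i, ∑ j, ∑ k, ∑ l, f i j k l = ∑ k, ∑ l, ∑ i, ∑ j, f i j k l :=
        sum_swap_pairs fun i j k l => f i j k l
    _ = _ := Finset.sum_congr rfl fun k _ => Finset.sum_congr rfl fun l _ => Finset.sum_comm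

theorem sq_norm_H01_le (w : H01 Ω) : ‖w‖ ^ 2 ≤ ‖toL2 w‖ ^ 2 + ∑ j, ‖grad w j‖ ^ 2 := by
  have h1 : ‖w‖ = max ‖toL2 w‖ ‖w.1.2‖ := rfl
  have h2 : ‖w.1.2‖ ^ 2 ≤ ∑ j, ‖grad w j‖ ^ 2 := sq_norm_pi_le_sum w.1.2
  have h3 := sq_nonneg ‖toL2 w‖
  have h4 := sq_nonneg ‖w.1.2‖
  rw [h1]
  rcases max_cases ‖toL2 w‖ ‖w.1.2‖ with h | h <;> rw [h.1] <;> linarith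

theorem sq_norm_pair_le (z : H01 Ω × (Fin 3 → H01 Ω)) : ‖z‖ ^ 2 ≤ ‖pairToL2L Ω z‖ ^ 2
    + (∑ i, ‖grad z.1 i‖ ^ 2 + ∑ i, ∑ j, ‖grad (z.2 i) j‖ ^ 2) := by
  have p1 : 0 ≤ ∑ i, ‖grad z.1 i‖ ^ 2 := Finset.sum_nonneg fun i _ => sq_nonneg _
  have p2 : ∀ i, 0 ≤ ∑ j, ‖grad (z.2 i) j‖ ^ 2 := fun i => Finset.sum_nonneg fun j _ => sq_nonneg _
  have p3 : 0 ≤ ∑ i, ∑ j, ‖grad (z.2 i) j‖ ^ 2 := Finset.sum_nonneg fun i _ => p2 i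
  have hfst : ‖toL2 z.1‖ ≤ ‖pairToL2L Ω z‖ := norm_fst_le (pairToL2L Ω z)
  have hsnd : ∀ i, ‖toL2 (z.2 i)‖ ≤ ‖pairToL2L Ω z‖ := fun i =>
    (norm_le_pi_norm (pairToL2L Ω z).2 i).trans (norm_snd_le (pairToL2L Ω z))
  set T := ‖pairToL2L Ω z‖ ^ 2 + (∑ i, ‖grad z.1 i‖ ^ 2 + ∑ i, ∑ j, ‖grad (z.2 i) j‖ ^ 2)
  have hT : 0 ≤ T := add_nonneg (sq_nonneg _) (add_nonneg p1 p3)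
  refine (Real.le_sqrt (norm_nonneg _) hT).1 (max_le ?_ ?_)
  · refine (Real.le_sqrt (norm_nonneg _) hT).2 ((sq_norm_H01_le z.1).trans ?_)
    have := pow_le_pow_left₀ (norm_nonneg _) hfst 2
    linarith
  · refine (pi_norm_le_iff_of_nonneg (Real.sqrt_nonneg _)).2 fun i => ?_
    refine (Real.le_sqrt (norm_nonneg _) hT).2 ((sq_norm_H01_le (z.2 i)).trans ?_)
    have h1 := pow_le_pow_left₀ (norm_nonneg _) (hsnd i) 2
    have h2 := Finset.single_le_sum (f := fun i => ∑ j, ‖grad (z.2 i) j‖ ^ 2)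
      (fun i _ => p2 i) (Finset.mem_univ i)
    linarith

/-- The dissipation controls the gradients; the same multiple of the L² part completes the full
norm, so no Poincaré inequality is required. -/
theorem dampZ_pos (hΩ : Bornology.IsBounded (Ω : Set E3)) (hC1 : m.IsC1 Ω) (hs : m.IsSymm Ω)
    (hd : m.DissipationPos Ω) : ∃ c > 0, ∃ C, ∀ z : H01 Ω × (Fin 3 → H01 Ω),
      c * ‖z‖ ^ 2 ≤ dampZ Ω m z z + C * ‖pairToL2L Ω z‖ ^ 2 := by
  obtain ⟨c, hc, h⟩ := hd
  refine ⟨c, hc, c, fun z => ?_⟩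
  have h1 := h z.1 z.2
  have i1 := (HasIntegralOn.sum Finset.univ fun i =>
      (Rep.refl (grad z.1 i)).hasIntegralOn_mul (Rep.refl (grad z.1 i))).add
    (HasIntegralOn.sum Finset.univ fun i => HasIntegralOn.sum Finset.univ fun j =>
      (Rep.refl (grad (z.2 i) j)).hasIntegralOn_mul (Rep.refl (grad (z.2 i) j)))
  have i2 := (HasIntegralOn.sum Finset.univ fun i => HasIntegralOn.sum Finset.univ fun j =>
      Rep.hasIntegralOn_coef (isCoef_of_contDiffOn_closure hΩ (hC1.Kt i j))
        (Rep.refl (grad z.1 i)) (Rep.refl (grad z.1 j))).add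
    (HasIntegralOn.sum Finset.univ fun i => HasIntegralOn.sum Finset.univ fun j =>
      HasIntegralOn.sum Finset.univ fun k => HasIntegralOn.sum Finset.univ fun l =>
      Rep.hasIntegralOn_coef (isCoef_of_contDiffOn_closure hΩ (hC1.Ct i j k l))
        (Rep.refl (grad (z.2 l) k)) (Rep.refl (grad (z.2 i) j)))
  rw [i1.2, i2.2] at h1
  simp only [real_inner_self_eq_norm_sq] at h1
  have h2 := mul_le_mul_of_nonneg_left (sq_norm_pair_le z) hc.le
  have h3 : ∑ i, ∑ j, coefForm Ω (m.Kt i j) (grad z.1 i) (grad z.1 j)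
      = ∑ i, ∑ j, coefForm Ω (m.Kt i j) (grad z.1 j) (grad z.1 i) :=
    Finset.sum_congr rfl fun i _ => Finset.sum_congr rfl fun j _ => coefForm_symm _ _
  have h4 : ∑ i, ∑ j, ∑ k, ∑ l, coefForm Ω (m.Ct i j k l) (grad (z.2 l) k) (grad (z.2 i) j)
      = ∑ i, ∑ j, ∑ k, ∑ l, coefForm Ω (m.Ct j i k l) (grad (z.2 k) l) (grad (z.2 i) j) := by
    -- The dissipation form and the field equation contract C̃ in different index orders;
    -- relabelling and the major symmetry reconcile them.
    rw [sum_rotate fun i j k l => coefForm Ω (m.Ct j i k l) (grad (z.2 k) l) (grad (z.2 i) j)]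
    refine Finset.sum_congr rfl fun i _ => Finset.sum_congr rfl fun j _ =>
      Finset.sum_congr rfl fun k _ => Finset.sum_congr rfl fun l _ => ?_
    rw [coefForm_symm, coefForm_congr fun x hx => hs.Ct_major x (subset_closure hx) i j k l]
  rw [h3, h4] at h1
  rw [dampZ_apply]
  linarith

theorem norm_toL2_le_vec (v : Fin 3 → H01 Ω) (i : Fin 3) : ‖toL2 (v i)‖ ≤ ‖vecToL2L Ω v‖ :=
  norm_le_pi_norm (vecToL2L Ω v) i

/-- The derivative is moved from the displacement to the temperature rate, which the damping
controls in the energy norm. -/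
theorem thermalU_le (hΩ : Bornology.IsBounded (Ω : Set E3)) (hC1 : m.IsC1 Ω) :
    ∃ C, ∀ (z : H01 Ω × (Fin 3 → H01 Ω)) (v : Fin 3 → H01 Ω),
      |thermalU Ω m z v| ≤ C * ‖z‖ * ‖vecToL2L Ω v‖ := by
  choose C hC0 hC using fun i j : Fin 3 => exists_abs_coefForm_grad_le hΩ (hC1.a j i) j
  refine ⟨∑ i, ∑ j, C i j, fun z v => ?_⟩
  rw [thermalU_apply]
  simp only [Finset.sum_mul]
  refine (Finset.abs_sum_le_sum_abs _ _).trans (Finset.sum_le_sum fun i _ =>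
    (Finset.abs_sum_le_sum_abs _ _).trans (Finset.sum_le_sum fun j _ => ?_))
  refine (hC i j z.1 (v i)).trans ?_
  exact mul_le_mul (mul_le_mul_of_nonneg_left (norm_fst_le z) (hC0 i j)) (norm_toL2_le_vec v i)
    (norm_nonneg _) (mul_nonneg (hC0 i j) (norm_nonneg _))

theorem thermalZ_le (hΩ : Bornology.IsBounded (Ω : Set E3)) (hC1 : m.IsC1 Ω) :
    ∃ C, ∀ (v : Fin 3 → H01 Ω) (z : H01 Ω × (Fin 3 → H01 Ω)),
      |thermalZ Ω m v z| ≤ C * ‖vecToL2L Ω v‖ * ‖z‖ := by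
  choose C hC0 hC using fun i j k : Fin 3 => exists_abs_coefForm_grad_le hΩ (hC1.a i j) k
  refine ⟨∑ i, ∑ j, (C i j i + C i j j), fun v z => ?_⟩
  rw [thermalZ_apply, abs_neg]
  simp only [Finset.sum_mul]
  refine (Finset.abs_sum_le_sum_abs _ _).trans (Finset.sum_le_sum fun i _ =>
    (Finset.abs_sum_le_sum_abs _ _).trans (Finset.sum_le_sum fun j _ => ?_))
  have key : ∀ k l, |coefForm Ω (m.a i j) (grad (v k) l) (toL2 z.1)|
      ≤ C i j l * (‖vecToL2L Ω v‖ * ‖z‖) := fun k l => by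
    rw [coefForm_symm]
    refine (hC i j l z.1 (v k)).trans ?_
    rw [mul_assoc, mul_comm ‖z.1‖]
    exact mul_le_mul_of_nonneg_left (mul_le_mul (norm_toL2_le_vec v k) (norm_fst_le z)
      (norm_nonneg _) (norm_nonneg _)) (hC0 i j l)
  have e : coefForm Ω (m.a i j) (strainL Ω v i j) (toL2 z.1)
      = (1 / 2 : ℝ) * (coefForm Ω (m.a i j) (grad (v i) j) (toL2 z.1)
        + coefForm Ω (m.a i j) (grad (v j) i) (toL2 z.1)) := by
    rw [strainL_apply, map_smul, map_add]
    rfl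
  rw [e, abs_mul, abs_of_pos (by norm_num : (0 : ℝ) < 1 / 2)]
  have h1 := key i j
  have h2 := key j i
  have h3 := abs_add_le (coefForm Ω (m.a i j) (grad (v i) j) (toL2 z.1))
    (coefForm Ω (m.a i j) (grad (v j) i) (toL2 z.1))
  have h4 := abs_nonneg (coefForm Ω (m.a i j) (grad (v i) j) (toL2 z.1)
    + coefForm Ω (m.a i j) (grad (v j) i) (toL2 z.1))
  linarith

/-- The forms of the linear theory of type III. -/
noncomputable def coupledForms (hΩ : Bornology.IsBounded (Ω : Set E3)) (hC1 : m.IsC1 Ω)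
    (hs : m.IsSymm Ω) (hin : m.InertiaPos Ω) (hst : m.StoredEnergyPos Ω)
    (hd : m.DissipationPos Ω) :
    CoupledForms (Fin 3 → H01 Ω) (H01 Ω × (Fin 3 → H01 Ω)) (Fin 3 → L2 Ω) (L2 Ω × (Fin 3 → L2 Ω))
      (Fin 3 → Fin 3 → L2 Ω) where
  ju := vecToL2L Ω
  jz := pairToL2L Ω
  E := strainL Ω
  mu := massU Ω m
  mz := massZ Ω m
  A := stiffU Ω m
  B₁ := coupleU Ω m
  B₂ := coupleZ Ω m
  K := stiffZ Ω m
  D := dampZ Ω m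
  n₁ := thermalU Ω m
  n₂ := thermalZ Ω m
  S₁ := lowerH Ω m
  S₂ := lowerV Ω m
  mu_symm := massU_symm
  mz_symm := massZ_symm hs
  A_symm _ _ := stiffU_symm hs _ _
  mu_pos := massU_pos hΩ hC1 hin
  mz_pos := massZ_pos hΩ hC1 hin
  A_pos := stiffU_pos hΩ hC1 hs hst
  D_pos := dampZ_pos hΩ hC1 hs hd
  n₁_le := thermalU_le hΩ hC1
  n₂_le := thermalZ_le hΩ hC1

/-- A symmetric stress sees only the symmetric part of the gradient. This turns the weak momentum
equation, tested with gradients, into one tested with strains. -/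
theorem sum_inner_strainL {s : Fin 3 → Fin 3 → L2 Ω} (hs : ∀ i j, s i j = s j i)
    (φ : Fin 3 → H01 Ω) : ∑ i, ∑ j, inner ℝ (s i j) (strainL Ω φ i j)
      = ∑ i, ∑ j, inner ℝ (s i j) (grad (φ i) j) := by
  have h1 : ∑ i, ∑ j, inner ℝ (s i j) (grad (φ j) i) = ∑ i, ∑ j, inner ℝ (s i j) (grad (φ i) j) := by
    rw [Finset.sum_comm]
    exact Finset.sum_congr rfl fun i _ => Finset.sum_congr rfl fun j _ => by rw [hs j i]
  simp only [strainL_apply, inner_smul_right, inner_add_right, ← Finset.mul_sum,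
    Finset.sum_add_distrib, h1]
  ring

theorem stiffU_strainL (hs : m.IsSymm Ω) (p : Fin 3 → Fin 3 → L2 Ω) (φ : Fin 3 → H01 Ω) :
    stiffU Ω m p (strainL Ω φ)
      = ∑ i, ∑ j, ∑ k, ∑ l, coefForm Ω (m.A j i k l) (p k l) (grad (φ i) j) := by
  have := sum_inner_strainL (s := fun i j => ∑ k, ∑ l, mulL Ω (m.A j i k l) (p k l)) (fun i j =>
    Finset.sum_congr rfl fun k _ => Finset.sum_congr rfl fun l _ => by
      rw [mulL_congr fun x hx => hs.A_minor x (subset_closure hx) j i k l]) φ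
  simpa only [sum_inner, inner_mulL, stiffU_apply] using this

theorem coupleU_strainL (hs : m.IsSymm Ω) (y : H01 Ω × (Fin 3 → H01 Ω)) (φ : Fin 3 → H01 Ω) :
    coupleU Ω m y (strainL Ω φ)
      = ∑ i, ∑ j, ∑ k, ∑ l, coefForm Ω (m.B j i k l) (grad (y.2 l) k) (grad (φ i) j) := by
  have := sum_inner_strainL (s := fun i j => ∑ k, ∑ l, mulL Ω (m.B j i k l) (grad (y.2 l) k))
    (fun i j => Finset.sum_congr rfl fun k _ => Finset.sum_congr rfl fun l _ => by
      rw [mulL_congr fun x hx => hs.B_minor x (subset_closure hx) j i k l]) φ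
  simpa only [sum_inner, inner_mulL, coupleU_apply] using this

/-! ### Weak form of the field equations. -/

variable {f : ℝ → Fin 3 → L2 Ω} {s : ℝ → L2 Ω} {Q : ℝ → Fin 3 → L2 Ω}
  {u : ℝ → Fin 3 → H01 Ω} {τ : ℝ → H01 Ω} {R : ℝ → Fin 3 → H01 Ω}

theorem weak_momentum (hΩ : Bornology.IsBounded (Ω : Set E3)) (hC1 : m.IsC1 Ω)
    (hsol : IsBackwardSolution Ω m (fun _ => 0) (fun _ => 0) (fun _ => 0) 0 0 0 0 0 0 u τ R)
    {t : ℝ} (ht : 0 < t) (i : Fin 3) (φ : H01 Ω) :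
    coefForm Ω m.rho (dt (fun r i' => toL2 (dt u r i')) t i) (toL2 φ)
      + ∑ j, ((∑ k, ∑ l, coefForm Ω (m.A j i k l) (strainL Ω (u t) k l) (grad φ j))
        + coefForm Ω (m.a j i) (toL2 (dt τ t)) (grad φ j)
        + ∑ k, ∑ l, coefForm Ω (m.B j i k l) (grad (R t l) k) (grad φ j)) = 0 := by
  have c {g : E3 → ℝ} (hg : ContDiffOn ℝ 1 g (closure (Ω : Set E3))) {P : L2 Ω} {p : E3 → ℝ}
      (hP : Rep P p) : Rep (mulL Ω g P) (fun x => g x * p x) :=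
    Rep.mulL (isCoef_of_contDiffOn_closure hΩ hg) hP
  have h := (hsol.momentum t ht i).inner_add_sum_inner_eq_zero
    (fun j => ((Rep.sum Finset.univ fun k => Rep.sum Finset.univ fun l =>
        c (hC1.A j i k l) (rep_strainL (u t) k l)).add (c (hC1.a j i) (Rep.refl _))).add
      (Rep.sum Finset.univ fun k => Rep.sum Finset.univ fun l => c (hC1.B j i k l) (Rep.refl _)))
    ((c hC1.rho (Rep.refl _)).sub (c hC1.rho (Rep.refl _))) φ
  simpa only [sum_inner, inner_add_left, inner_sub_left, inner_mulL, Pi.zero_apply, map_zero,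
    _root_.zero_apply, sub_zero] using h

theorem weak_entropy (hΩ : Bornology.IsBounded (Ω : Set E3)) (hC1 : m.IsC1 Ω)
    (hsol : IsBackwardSolution Ω m (fun _ => 0) (fun _ => 0) (fun _ => 0) 0 0 0 0 0 0 u τ R)
    {t : ℝ} (ht : 0 < t) (φ : H01 Ω) :
    coefForm Ω m.c (dt (fun r => toL2 (dt τ r)) t) (toL2 φ)
      - (∑ i, ∑ j, coefForm Ω (m.a i j) (strainL Ω (dt u t) i j) (toL2 φ))
      - (∑ i, ∑ j, coefForm Ω (m.b i j) (grad (dt R t i) j) (toL2 φ))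
      + ∑ i, ∑ j, (coefForm Ω (m.d i j) (toL2 (dt R t j)) (grad φ i)
        + coefForm Ω (m.K i j) (grad (τ t) j) (grad φ i)
        - coefForm Ω (m.Kt i j) (grad (dt τ t) j) (grad φ i)) = 0 := by
  have c {g : E3 → ℝ} (hg : ContDiffOn ℝ 1 g (closure (Ω : Set E3))) {P : L2 Ω} {p : E3 → ℝ}
      (hP : Rep P p) : Rep (mulL Ω g P) (fun x => g x * p x) :=
    Rep.mulL (isCoef_of_contDiffOn_closure hΩ hg) hP
  have h := (hsol.entropy t ht).inner_add_sum_inner_eq_zero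
    (fun i => Rep.sum Finset.univ fun j => ((c (hC1.d i j) (Rep.refl _)).add
      (c (hC1.K i j) (Rep.refl _))).sub (c (hC1.Kt i j) (Rep.refl _)))
    ((((c hC1.c (Rep.refl _)).sub (Rep.sum Finset.univ fun i => Rep.sum Finset.univ fun j =>
      c (hC1.a i j) (rep_strainL (dt u t) i j))).sub
      (Rep.sum Finset.univ fun i => Rep.sum Finset.univ fun j =>
        c (hC1.b i j) (Rep.refl _))).sub (c hC1.rho (Rep.refl _))) φ
  simpa only [sum_inner, inner_add_left, inner_sub_left, inner_mulL, map_zero,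
    _root_.zero_apply, sub_zero] using h

theorem weak_moment (hΩ : Bornology.IsBounded (Ω : Set E3)) (hC1 : m.IsC1 Ω)
    (hsol : IsBackwardSolution Ω m (fun _ => 0) (fun _ => 0) (fun _ => 0) 0 0 0 0 0 0 u τ R)
    {t : ℝ} (ht : 0 < t) (i : Fin 3) (φ : H01 Ω) :
    (∑ j, coefForm Ω (m.cm i j) (dt (fun r j' => toL2 (dt R r j')) t j) (toL2 φ))
      - (∑ j, coefForm Ω (m.d i j) (grad (dt τ t) j) (toL2 φ))
      + ∑ j, ((∑ k, ∑ l, coefForm Ω (m.B k l j i) (strainL Ω (u t) k l) (grad φ j))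
        + coefForm Ω (m.b j i) (toL2 (dt τ t)) (grad φ j)
        + (∑ k, ∑ l, coefForm Ω (m.C j i k l) (grad (R t k) l) (grad φ j))
        - ∑ k, ∑ l, coefForm Ω (m.Ct j i k l) (grad (dt R t k) l) (grad φ j)) = 0 := by
  have c {g : E3 → ℝ} (hg : ContDiffOn ℝ 1 g (closure (Ω : Set E3))) {P : L2 Ω} {p : E3 → ℝ}
      (hP : Rep P p) : Rep (mulL Ω g P) (fun x => g x * p x) :=
    Rep.mulL (isCoef_of_contDiffOn_closure hΩ hg) hP
  have h := (hsol.moment t ht i).inner_add_sum_inner_eq_zero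
    (fun j => (((Rep.sum Finset.univ fun k => Rep.sum Finset.univ fun l =>
        c (hC1.B k l j i) (rep_strainL (u t) k l)).add (c (hC1.b j i) (Rep.refl _))).add
      (Rep.sum Finset.univ fun k => Rep.sum Finset.univ fun l =>
        c (hC1.C j i k l) (Rep.refl _))).sub
      (Rep.sum Finset.univ fun k => Rep.sum Finset.univ fun l => c (hC1.Ct j i k l) (Rep.refl _)))
    (((Rep.sum Finset.univ fun j => c (hC1.cm i j) (Rep.refl _)).sub
      (Rep.sum Finset.univ fun j => c (hC1.d i j) (Rep.refl _))).sub (c hC1.rho (Rep.refl _))) φ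
  simpa only [sum_inner, inner_add_left, inner_sub_left, inner_mulL, Pi.zero_apply, map_zero,
    _root_.zero_apply, sub_zero] using h

theorem hasDerivWithinAt_dt {X : Type*} [NormedAddCommGroup X] [NormedSpace ℝ X] {g : ℝ → X}
    (hg : ContDiffOn ℝ 1 g (Ici 0)) {t : ℝ} (ht : 0 ≤ t) :
    HasDerivWithinAt g (dt g t) (Ici 0) t :=
  (hg.differentiableOn one_ne_zero t ht).hasDerivWithinAt

theorem continuousOn_dt {X : Type*} [NormedAddCommGroup X] [NormedSpace ℝ X] {g : ℝ → X}
    (hg : ContDiffOn ℝ 1 g (Ici 0)) : ContinuousOn (dt g) (Ici 0) :=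
  hg.continuousOn_derivWithin (uniqueDiffOn_Ici 0) le_rfl

set_option maxHeartbeats 1000000 in
theorem IsBackwardSolution.isNullSolution (hΩ : Bornology.IsBounded (Ω : Set E3)) (hC1 : m.IsC1 Ω)
    (hs : m.IsSymm Ω) (hin : m.InertiaPos Ω) (hst : m.StoredEnergyPos Ω)
    (hd : m.DissipationPos Ω)
    (hsol : IsBackwardSolution Ω m (fun _ => 0) (fun _ => 0) (fun _ => 0) 0 0 0 0 0 0 u τ R) :
    (coupledForms hΩ hC1 hs hin hst hd).IsNullSolution u (dt u) (fun t => (τ t, R t))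
      (fun t => (dt τ t, dt R t)) (dt fun r i => toL2 (dt u r i))
      (fun t => (dt (fun r => toL2 (dt τ r)) t, dt (fun r i => toL2 (dt R r i)) t)) where
  cont_v := continuousOn_dt hsol.contDiff_u
  cont_z := (continuousOn_dt hsol.contDiff_τ).prodMk (continuousOn_dt hsol.contDiff_R)
  cont_v' := continuousOn_dt hsol.contDiff_v
  cont_z' := (continuousOn_dt hsol.contDiff_θ).prodMk (continuousOn_dt hsol.contDiff_M)
  deriv_u t ht := hasDerivWithinAt_dt hsol.contDiff_u ht
  deriv_y t ht := (hasDerivWithinAt_dt hsol.contDiff_τ ht).prodMk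
    (hasDerivWithinAt_dt hsol.contDiff_R ht)
  deriv_v t ht := hasDerivWithinAt_dt hsol.contDiff_v ht
  deriv_z t ht := (hasDerivWithinAt_dt hsol.contDiff_θ ht).prodMk
    (hasDerivWithinAt_dt hsol.contDiff_M ht)
  init_u := hsol.init_u
  init_y := Prod.ext hsol.init_τ hsol.init_R
  init_v := funext hsol.init_v
  init_z := Prod.ext hsol.init_θ (funext hsol.init_M)
  eq_u t ht φ := by
    change massU Ω m _ (vecToL2L Ω φ) + stiffU Ω m (strainL Ω (u t)) (strainL Ω φ)
      + coupleU Ω m (τ t, R t) (strainL Ω φ) + thermalU Ω m (dt τ t, dt R t) φ = 0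
    rw [massU_apply, stiffU_strainL hs, coupleU_strainL hs, thermalU_apply]
    -- Each component equation is tested with its own component of φ, and the results are added.
    have h := Finset.sum_eq_zero fun i (_ : i ∈ Finset.univ) =>
      weak_momentum hΩ hC1 hsol ht i (φ i)
    simp only [Finset.sum_add_distrib] at h
    have e : ∀ i, vecToL2L Ω φ i = toL2 (φ i) := fun _ => rfl
    simp only [e]
    linarith
  eq_z t ht ψ := by
    change massZ Ω m _ (pairToL2L Ω ψ) + coupleZ Ω m (strainL Ω (u t)) ψ
      + stiffZ Ω m (τ t, R t) ψ + thermalZ Ω m (dt u t) ψ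
      + lowerH Ω m (pairToL2L Ω (dt τ t, dt R t)) ψ + lowerV Ω m (dt τ t, dt R t) (pairToL2L Ω ψ)
      - dampZ Ω m (dt τ t, dt R t) ψ = 0
    rw [massZ_apply, coupleZ_apply, stiffZ_apply, thermalZ_apply, lowerH_apply, lowerV_apply,
      dampZ_apply]
    have h1 := weak_entropy hΩ hC1 hsol ht ψ.1
    have h2 := Finset.sum_eq_zero fun i (_ : i ∈ Finset.univ) =>
      weak_moment hΩ hC1 hsol ht i (ψ.2 i)
    simp only [Finset.sum_add_distrib, Finset.sum_sub_distrib] at h1 h2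
    have e1 : ∀ z : H01 Ω × (Fin 3 → H01 Ω), (pairToL2L Ω z).1 = toL2 z.1 := fun _ => rfl
    have e2 : ∀ (z : H01 Ω × (Fin 3 → H01 Ω)) (i : Fin 3), (pairToL2L Ω z).2 i = toL2 (z.2 i) :=
      fun _ _ => rfl
    simp only [e1, e2]
    linarith

end TypeIII

/-! ### Uniqueness for the backward system. -/

theorem mainTheorem5 (Ω : TopologicalSpace.Opens TypeIII.E3)
    (hΩ : Bornology.IsBounded (Ω : Set TypeIII.E3))
    (m : TypeIII.Material) (hC1 : m.IsC1 Ω) (hsymm : m.IsSymm Ω) (hinertia : m.InertiaPos Ω)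
    (hstored : m.StoredEnergyPos Ω) (hdiss : m.DissipationPos Ω)
    (u : ℝ → Fin 3 → TypeIII.H01 Ω) (τ : ℝ → TypeIII.H01 Ω) (R : ℝ → Fin 3 → TypeIII.H01 Ω)
    (hsol : TypeIII.IsBackwardSolution Ω m
      (fun _ => 0) (fun _ => 0) (fun _ => 0) 0 0 0 0 0 0 u τ R) :
    ∀ t : ℝ, 0 ≤ t → u t = 0 ∧ τ t = 0 ∧ R t = 0 := by
  intro t ht
  have : CompleteSpace (TypeIII.H01 Ω) :=
    (Submodule.isClosed_topologicalClosure _).completeSpace_coe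
  obtain ⟨h1, h2⟩ := (hsol.isNullSolution hΩ hC1 hsymm hinertia hstored hdiss).eq_zero ht
  exact ⟨funext fun i => TypeIII.toL2_injective (congrFun h1 i),
    TypeIII.toL2_injective (congrArg Prod.fst h2),
    funext fun i => TypeIII.toL2_injective (congrFun (congrArg Prod.snd h2) i)⟩
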